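/- Let $T:\mathbb{R}\to\mathbb{R}$ be the map $Tx=\frac12\left(x-\frac1x\right)$ for $x\neq 0$, $T0=0$, and let $\|\cdot\|_2$ be the norm of $L^2(\mu)$ for the probability measure $d\mu(x)=\frac{1}{\pi}\frac{dx}{1+x^2}$ on $\mathbb{R}$, which $T$ preserves. For $s\in\mathbb{C}$ with $\frac12<\Re s<1$, $x\in\mathbb{R}$ and $N\ge 1$ put $$Y_N(s)=Y_N(s,x)=\frac1N\sum_{n=0}^{N-1}\zeta(s+iT^nx),$$ where $\zeta$ is the Riemann zeta function. There is an absolute constant $C>0$ such that for all real $\sigma, t$ with $\frac12<\sigma<1$, writing $s=\sigma+it$, and for every strictly increasing sequence $(N_k)_{k\ge1}$ of positive integers, $$\sum_{k=1}^{\infty}\Big\|\sup_{N_k\le N<N_{k+1}}\big|Y_N(s)-Y_{N_k}(s)\big|\Big\|_2^2\le\frac{C\,(1+t^2)}{\pi\sigma}\left|\frac{\zeta(2\sigma)}{2}+\frac{\zeta(2\sigma-1)}{2\sigma-1}\right| .$$ In particular, for real $s=\sigma$ the left side is at most $\frac{C}{\pi\sigma}\left|\frac{\zeta(2\sigma)}{2}+\frac{\zeta(2\sigma-1)}{2\sigma-1}\right|$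 with $C$ absolute. -/

import Mathlib

open MeasureTheory ProbabilityTheory
open scoped ENNReal

/-- The Boole-type transformation `T x = (x - 1/x) / 2` of the real line, with `T 0 = 0`. It
preserves the standard Cauchy probability measure `dx / (π (1 + x ^ 2))`, which is
`cauchyMeasure 0 1`. -/
noncomputable def booleMap (x : ℝ) : ℝ :=
  if x = 0 then 0 else (1 / 2) * (x - 1 / x)

/-- `Y_N(s, x) = (1 / N) ∑_{n = 0}^{N - 1} ζ(s + i T^n x)`. -/
noncomputable def zetaAverage (s : ℂ) (N : ℕ) (x : ℝ) : ℂ :=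
  birkhoffAverage ℂ booleMap (fun y : ℝ => riemannZeta (s + Complex.I * (y : ℂ))) N x

/-- The oscillation `sup_{M ≤ N < M'} |Y_N(s, x) - Y_M(s, x)|`, as an extended nonnegative real. -/
noncomputable def zetaOscillation (s : ℂ) (M M' : ℕ) (x : ℝ) : ℝ≥0∞ :=
  ⨆ N ∈ Set.Ico M M', ‖zetaAverage s N x - zetaAverage s M x‖ₑ

/-! The bound is the product of two independent facts: an $L^2$ oscillation inequality for Birkhoff
averages of any measure-preserving map, with an absolute constant
(`DyadicOscillation.tsum_lintegral_birkhoffOscillation_sq_le`), and an estimate of the $L^2(\mu)$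
norm of $x\mapsto\zeta(s+ix)$ (`lintegral_riemannZeta_cauchyMeasure_le`). They are joined by the
invariance of the Cauchy measure, `measurePreserving_booleMap`.

Oscillation. By transference along orbits it suffices to treat forward averages $A_n$ of a finitely
supported sequence. These are compared with the means $E_p$ over dyadic blocks of length $2^p$,
which form a reversed martingale. Oscillations of $E_p$ are controlled by Doob's maximal inequality,
and the resulting energies telescope (`sum_sq_dyMean_choice_le`). For $2^p\le n\le 2^{p+1}$ the
error $A_nf-E_pf$ is split along the martingale differences $d_j$ of $f$. A coarse $d_j$ ($j\ge p$)
is nearly invariant under shifts by at most $n$; a fine one ($j<p$) has mean zero on blocks much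
shorter than $n$. In both cases the error and its variation in $n$ have energy
$O(2^{-|p-j|}\|d_j\|^2)$ (`sum_blockVar_le_coarse`, `sum_blockVar_le_fine`), so a weighted
Cauchy-Schwarz inequality sums over all pairs of scales (`sum_sum_totalVar_le`).

Norm of zeta. In the critical strip $-\zeta(s)/s$ is the Mellin transform of the fractional part
$\{t\}$ at $-s$ (`mellin_fract`). Plancherel turns the mean square of $\zeta(s)/s$ on $\Re s=\sigma$
into $2\pi\int_0^\infty\{t\}^2t^{-2\sigma-1}dt$, and this is evaluated by zeta at $2\sigma$ and
$2\sigma-1$ (`mellin_fract_sq`). The Cauchy density is at most a multiple of $(1+t^2)/|s+ix|^2$,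
which produces the factor $1+t^2$. -/

namespace DyadicOscillation

open Finset

/-! ### Dyadic means as conditional expectations -/

/-- The forward average `(1 / n) ∑_{m < n} f (x + m)`. -/
noncomputable def fwdAvg (f : ℕ → ℝ) (n x : ℕ) : ℝ := (∑ m ∈ range n, f (x + m)) / n

/-- The mean of `f` over the dyadic interval of length `2 ^ p` containing `x`. -/
noncomputable def dyMean (p : ℕ) (f : ℕ → ℝ) (x : ℕ) : ℝ :=
  (∑ y ∈ range (2 ^ p), f (2 ^ p * (x / 2 ^ p) + y)) / 2 ^ p

/-- `g` is constant on each of the intervals `[l u, l (u + 1))`. -/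
def BlockConst (l : ℕ) (g : ℕ → ℝ) : Prop := ∀ x y, x / l = y / l → g x = g y

lemma sum_range_mul (h : ℕ → ℝ) (l Q : ℕ) :
    ∑ x ∈ range (l * Q), h x = ∑ u ∈ range Q, ∑ v ∈ range l, h (l * u + v) := by
  induction Q with
  | zero => simp
  | succ Q ih => rw [mul_add, mul_one, sum_range_add, ih, sum_range_succ]

lemma BlockConst.eq_left {l : ℕ} {g : ℕ → ℝ} (hg : BlockConst l g) (u : ℕ) {v : ℕ} (hv : v < l) :
    g (l * u + v) = g (l * u) := by
  apply hg
  have hl : 0 < l := by omega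
  rw [Nat.mul_add_div hl, Nat.div_eq_of_lt hv, Nat.mul_div_cancel_left _ hl, add_zero]

lemma BlockConst.of_dvd {l l' : ℕ} (h : l ∣ l') {g : ℕ → ℝ} (hg : BlockConst l' g) :
    BlockConst l g := by
  obtain ⟨k, rfl⟩ := h
  intro x y hxy
  apply hg
  rw [← Nat.div_div_eq_div_mul, ← Nat.div_div_eq_div_mul, hxy]

lemma blockConst_dyMean (p : ℕ) (f : ℕ → ℝ) : BlockConst (2 ^ p) (dyMean p f) := by
  intro x y h
  simp only [dyMean, h]

lemma BlockConst.comp₂ {l : ℕ} {g h : ℕ → ℝ} (hg : BlockConst l g) (hh : BlockConst l h)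
    (F : ℝ → ℝ → ℝ) : BlockConst l (fun x => F (g x) (h x)) := by
  intro x y hxy
  simp only [hg x y hxy, hh x y hxy]

/-- The defining property of conditional expectation: a factor constant on blocks does not notice
averaging over them. All orthogonality below comes from this. -/
lemma sum_mul_dyMean {p Q : ℕ} {g : ℕ → ℝ} (hg : BlockConst (2 ^ p) g) (f : ℕ → ℝ) :
    ∑ x ∈ range (2 ^ p * Q), g x * dyMean p f x = ∑ x ∈ range (2 ^ p * Q), g x * f x := by
  rw [sum_range_mul, sum_range_mul]
  refine sum_congr rfl fun u _ => ?_
  have h2 : (0 : ℕ) < 2 ^ p := by positivity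
  calc ∑ v ∈ range (2 ^ p), g (2 ^ p * u + v) * dyMean p f (2 ^ p * u + v)
      = ∑ v ∈ range (2 ^ p), g (2 ^ p * u) * dyMean p f (2 ^ p * u) := by
        refine sum_congr rfl fun v hv => ?_
        rw [hg.eq_left u (mem_range.1 hv), (blockConst_dyMean p f).eq_left u (mem_range.1 hv)]
    _ = g (2 ^ p * u) * ∑ v ∈ range (2 ^ p), f (2 ^ p * u + v) := by
        rw [sum_const, card_range, nsmul_eq_mul, dyMean, Nat.mul_div_cancel_left _ h2]
        push_cast
        field_simp
    _ = ∑ v ∈ range (2 ^ p), g (2 ^ p * u + v) * f (2 ^ p * u + v) := by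
        rw [mul_sum]
        refine sum_congr rfl fun v hv => ?_
        rw [hg.eq_left u (mem_range.1 hv)]

lemma dyMean_zero (f : ℕ → ℝ) : dyMean 0 f = f := by
  ext x; simp [dyMean]

lemma dyMean_eq_zero {p J : ℕ} (hp : p ≤ J) {f : ℕ → ℝ} (hf : ∀ x, 2 ^ J ≤ x → f x = 0)
    {x : ℕ} (hx : 2 ^ J ≤ x) : dyMean p f x = 0 := by
  rw [dyMean, sum_eq_zero, zero_div]
  intro y _
  apply hf
  obtain ⟨k, rfl⟩ := Nat.exists_eq_add_of_le hp
  rw [pow_add] at hx ⊢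
  have : 2 ^ k ≤ x / 2 ^ p := by
    rw [Nat.le_div_iff_mul_le (by positivity), mul_comm]; exact hx
  calc 2 ^ p * 2 ^ k ≤ 2 ^ p * (x / 2 ^ p) := Nat.mul_le_mul_left _ this
    _ ≤ _ := Nat.le_add_right _ _

lemma sum_mul_dyMean_pow {p J : ℕ} (hp : p ≤ J) {g : ℕ → ℝ} (hg : BlockConst (2 ^ p) g)
    (f : ℕ → ℝ) :
    ∑ x ∈ range (2 ^ J), g x * dyMean p f x = ∑ x ∈ range (2 ^ J), g x * f x := by
  obtain ⟨k, rfl⟩ := Nat.exists_eq_add_of_le hp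
  rw [pow_add]
  exact sum_mul_dyMean hg f

lemma sum_sq_dyMean_sub {p q J : ℕ} (hpq : p ≤ q) (hq : q ≤ J) (f : ℕ → ℝ) :
    ∑ x ∈ range (2 ^ J), (dyMean p f x - dyMean q f x) ^ 2 =
      ∑ x ∈ range (2 ^ J), dyMean p f x ^ 2 - ∑ x ∈ range (2 ^ J), dyMean q f x ^ 2 := by
  have hc := blockConst_dyMean q f
  have h1 := sum_mul_dyMean_pow hq hc f
  have h2 := sum_mul_dyMean_pow (hpq.trans hq) (hc.of_dvd (pow_dvd_pow 2 hpq)) f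
  rw [← h1] at h2
  have : ∀ x, (dyMean p f x - dyMean q f x) ^ 2 =
      dyMean p f x ^ 2 - dyMean q f x ^ 2 -
        2 * (dyMean q f x * dyMean p f x - dyMean q f x * dyMean q f x) := fun x => by ring
  simp only [this, sum_sub_distrib, ← mul_sum, h2]
  ring

/-! ### The dyadic maximal inequality -/

/-- Doob's $L^2$ inequality for the martingale that refines scale $q$ step by step. With $a_r$ the
absolute value and $M_r$ its running maximum, $\sum_x(2M_ra_r-M_r^2)$ is nondecreasing in $r$, hence
nonnegative; this gives $\|M_r\|\le 2\|a_r\|$. -/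
lemma sum_partialSups_sq_le {J q : ℕ} (hq : q ≤ J) (f : ℕ → ℝ) {r : ℕ} (hr : r ≤ q) :
    ∑ x ∈ range (2 ^ J),
        partialSups (fun i => |dyMean (q - i) f x - dyMean q f x|) r ^ 2 ≤
      4 * ∑ x ∈ range (2 ^ J), (dyMean (q - r) f x - dyMean q f x) ^ 2 := by
  set a : ℕ → ℕ → ℝ := fun x i => |dyMean (q - i) f x - dyMean q f x| with ha
  have hconst : ∀ r, BlockConst (2 ^ (q - r)) fun x => partialSups (a x) r := by
    intro r
    induction r with
    | zero =>
      simp only [partialSups_zero]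
      exact (blockConst_dyMean q f).comp₂ (blockConst_dyMean q f) fun u v => |u - v|
    | succ r ih =>
      simp only [partialSups_add_one]
      have h1 := ih.of_dvd (pow_dvd_pow 2 (show q - (r + 1) ≤ q - r by omega))
      have h2 := (blockConst_dyMean q f).of_dvd (pow_dvd_pow 2 (show q - (r + 1) ≤ q by omega))
      exact h1.comp₂ ((blockConst_dyMean (q - (r + 1)) f).comp₂ h2 fun u v => |u - v|) (· ⊔ ·)
  have key : ∀ r, r ≤ q → 0 ≤ ∑ x ∈ range (2 ^ J),
      (2 * partialSups (a x) r * a x r - partialSups (a x) r ^ 2) := by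
    intro r
    induction r with
    | zero => intro _; simp [ha]
    | succ r ih =>
      intro hr
      refine (ih (by omega)).trans ?_
      -- The submartingale property of $a_r$: multiplying by the current sign linearises the
      -- absolute value, and $M_r$ times this sign is known at scale $q-r$, so it is orthogonal to
      -- the next increment.
      set s : ℕ → ℝ := fun x => SignType.sign (dyMean (q - r) f x - dyMean q f x) with hs
      have hsb : BlockConst (2 ^ (q - r)) s :=
        (blockConst_dyMean (q - r) f).comp₂
          ((blockConst_dyMean q f).of_dvd (pow_dvd_pow 2 (Nat.sub_le q r)))
          fun u v => (SignType.sign (u - v) : ℝ)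
      have hg := (hconst r).comp₂ hsb fun u v => u * v
      have h1 := sum_mul_dyMean_pow ((Nat.sub_le q r).trans hq) hg f
      have h2 := sum_mul_dyMean_pow ((Nat.sub_le q (r + 1)).trans hq)
        (hg.of_dvd (pow_dvd_pow 2 (show q - (r + 1) ≤ q - r by omega))) f
      have h3 : ∑ x ∈ range (2 ^ J), 2 * (partialSups (a x) r * s x *
          dyMean (q - (r + 1)) f x - partialSups (a x) r * s x * dyMean (q - r) f x) = 0 := by
        rw [← mul_sum, sum_sub_distrib, h1, h2, sub_self, mul_zero]
      rw [← sub_nonneg, ← sum_sub_distrib, ← h3]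
      refine sum_le_sum fun x _ => ?_
      have hM0 : 0 ≤ partialSups (a x) r := (abs_nonneg _).trans (le_partialSups (a x) r)
      have hsub : partialSups (a x) r * (s x * (dyMean (q - (r + 1)) f x - dyMean q f x)) ≤
          partialSups (a x) r * a x (r + 1) := by
        refine mul_le_mul_of_nonneg_left ?_ hM0
        simp only [hs, ha]
        rcases lt_trichotomy (dyMean (q - r) f x - dyMean q f x) 0 with h | h | h
        · simp only [sign_neg h, SignType.coe_neg_one]
          exact (le_of_eq (by ring)).trans (neg_le_abs _)
        · simp [h]
        · simp only [sign_pos h, SignType.coe_one, one_mul]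
          exact le_abs_self _
      have hsub' : s x * (dyMean (q - r) f x - dyMean q f x) = a x r := sign_mul_self _
      -- Pathwise: if the maximum is unchanged the two sides agree; if it jumps to $a_{r+1}$ they
      -- differ by $(a_{r+1}-M_r)^2$.
      have hgoal : 2 * partialSups (a x) r * (a x (r + 1) - a x r) ≤
          2 * partialSups (a x) (r + 1) * a x (r + 1) - partialSups (a x) (r + 1) ^ 2 -
          (2 * partialSups (a x) r * a x r - partialSups (a x) r ^ 2) := by
        rw [partialSups_add_one]
        rcases le_total (partialSups (a x) r) (a x (r + 1)) with h | h
        · rw [sup_eq_right.2 h]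
          nlinarith [sq_nonneg (partialSups (a x) r - a x (r + 1))]
        · rw [sup_eq_left.2 h]
          linarith
      refine le_trans ?_ hgoal
      rw [← hsub']
      linarith
  have hk := key r hr
  rw [sum_sub_distrib] at hk
  have h4 : ∑ x ∈ range (2 ^ J), 2 * partialSups (a x) r * a x r ≤
      ∑ x ∈ range (2 ^ J), (partialSups (a x) r ^ 2 / 2 + 2 * a x r ^ 2) :=
    sum_le_sum fun x _ => by nlinarith [sq_nonneg (partialSups (a x) r - 2 * a x r)]
  rw [sum_add_distrib, ← sum_div, ← mul_sum] at h4
  have h5 : ∑ x ∈ range (2 ^ J), a x r ^ 2 =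
      ∑ x ∈ range (2 ^ J), (dyMean (q - r) f x - dyMean q f x) ^ 2 := by
    simp only [ha, sq_abs]
  rw [← h5]
  linarith

/-- The scale may depend on the point, so this is a maximal inequality. Both means are compared with
the coarsest one, at $q'$; Doob gives the constant $2\cdot4+2$. The right side is a difference of
energies so that it telescopes over consecutive ranges of scales. -/
lemma sum_sq_dyMean_choice_le {J q q' : ℕ} (hqq : q ≤ q') (hq : q' ≤ J) (f : ℕ → ℝ) (p : ℕ → ℕ)
    (hp : ∀ x, q ≤ p x ∧ p x ≤ q') :
    ∑ x ∈ range (2 ^ J), (dyMean (p x) f x - dyMean q f x) ^ 2 ≤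
      10 * (∑ x ∈ range (2 ^ J), dyMean q f x ^ 2 - ∑ x ∈ range (2 ^ J), dyMean q' f x ^ 2) := by
  rw [← sum_sq_dyMean_sub hqq hq]
  have h := sum_partialSups_sq_le hq f (Nat.sub_le q' q)
  rw [Nat.sub_sub_self hqq] at h
  calc _ ≤ ∑ x ∈ range (2 ^ J),
        (2 * partialSups (fun i => |dyMean (q' - i) f x - dyMean q' f x|) (q' - q) ^ 2 +
          2 * (dyMean q f x - dyMean q' f x) ^ 2) := by
        refine sum_le_sum fun x _ => ?_
        have h1 := le_partialSups_of_le (fun i => |dyMean (q' - i) f x - dyMean q' f x|)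
          (show q' - p x ≤ q' - q by have := (hp x).1; omega)
        simp only [Nat.sub_sub_self (hp x).2] at h1
        have h2 := pow_le_pow_left₀ (abs_nonneg _) h1 2
        rw [sq_abs] at h2
        nlinarith [sq_nonneg (dyMean (p x) f x - dyMean q' f x + (dyMean q f x - dyMean q' f x))]
    _ ≤ _ := by
        rw [sum_add_distrib, ← mul_sum, ← mul_sum]
        linarith

/-! ### Shifts and averages of block functions -/

lemma sum_shift_le {g : ℕ → ℝ} {P : ℕ} (hg : ∀ x, 0 ≤ g x) (hP : ∀ x, P ≤ x → g x = 0) (m : ℕ) :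
    ∑ x ∈ range P, g (x + m) ≤ ∑ x ∈ range P, g x := by
  calc ∑ x ∈ range P, g (x + m) ≤ ∑ x ∈ range m, g x + ∑ x ∈ range P, g (m + x) := by
        simp only [add_comm m]
        exact le_add_of_nonneg_left (sum_nonneg fun _ _ => hg _)
    _ = ∑ x ∈ range (P + m), g x := by rw [add_comm P, sum_range_add]
    _ = ∑ x ∈ range P, g x := by
        rw [sum_range_add, sum_eq_zero (s := range m) fun x _ => hP _ (Nat.le_add_right _ _), add_zero]

/-- For $m\le 2^j$ a shift by $m$ changes the value only at the last $m$ points of each block, where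
the change is the jump to the next block. For larger $m$ the triangle inequality suffices. -/
lemma sum_sq_shift_sub_le {j J : ℕ} (hj : j ≤ J) {d : ℕ → ℝ} (hd : BlockConst (2 ^ j) d)
    (hP : ∀ x, 2 ^ J ≤ x → d x = 0) (m : ℕ) :
    2 ^ j * ∑ x ∈ range (2 ^ J), (d (x + m) - d x) ^ 2 ≤
      4 * m * ∑ x ∈ range (2 ^ J), d x ^ 2 := by
  have hP2 : ∀ x, 2 ^ J ≤ x → d x ^ 2 = 0 := fun x hx => by rw [hP x hx]; norm_num
  have hN : 0 ≤ ∑ x ∈ range (2 ^ J), d x ^ 2 := sum_nonneg fun _ _ => sq_nonneg _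
  rcases le_total (2 ^ j) m with hm | hm
  · have h1 : ∑ x ∈ range (2 ^ J), (d (x + m) - d x) ^ 2 ≤ 4 * ∑ x ∈ range (2 ^ J), d x ^ 2 := by
      calc _ ≤ ∑ x ∈ range (2 ^ J), (2 * d (x + m) ^ 2 + 2 * d x ^ 2) :=
            sum_le_sum fun x _ => by nlinarith [sq_nonneg (d (x + m) + d x)]
        _ ≤ _ := by
            rw [sum_add_distrib, ← mul_sum, ← mul_sum]
            linarith [sum_shift_le (fun x => sq_nonneg (d x)) hP2 m]
    have hm' : (2 : ℝ) ^ j ≤ m := by exact_mod_cast hm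
    calc _ ≤ (2 : ℝ) ^ j * (4 * ∑ x ∈ range (2 ^ J), d x ^ 2) := by gcongr
      _ ≤ (m : ℝ) * (4 * ∑ x ∈ range (2 ^ J), d x ^ 2) := by gcongr
      _ = _ := by ring
  · obtain ⟨k, rfl⟩ := Nat.exists_eq_add_of_le hj
    obtain ⟨r, hr⟩ := Nat.exists_eq_add_of_le hm
    have hblock : ∀ u, ∑ v ∈ range (2 ^ j), (d (2 ^ j * u + v + m) - d (2 ^ j * u + v)) ^ 2 =
        m * (d (2 ^ j * (u + 1)) - d (2 ^ j * u)) ^ 2 := by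
      intro u
      rw [show range (2 ^ j) = range (r + m) by rw [hr, add_comm], sum_range_add, sum_eq_zero,
        zero_add]
      · rw [← nsmul_eq_mul]
        nth_rw 3 [← card_range m]
        rw [← sum_const]
        refine sum_congr rfl fun v hv => ?_
        have hv := mem_range.1 hv
        rw [hd.eq_left u (show r + v < 2 ^ j by omega),
          show 2 ^ j * u + (r + v) + m = 2 ^ j * (u + 1) + v by rw [mul_add, hr]; ring,
          hd.eq_left (u + 1) (show v < 2 ^ j by omega)]
      · intro v hv
        have hv := mem_range.1 hv
        rw [add_assoc, hd.eq_left u (show v + m < 2 ^ j by omega),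
          hd.eq_left u (show v < 2 ^ j by omega), sub_self]
        norm_num
    have hsum : ∑ x ∈ range (2 ^ (j + k)), d x ^ 2 =
        2 ^ j * ∑ u ∈ range (2 ^ k), d (2 ^ j * u) ^ 2 := by
      rw [pow_add, sum_range_mul, mul_sum]
      refine sum_congr rfl fun u _ => ?_
      rw [sum_congr rfl fun v hv => by rw [hd.eq_left u (mem_range.1 hv)], sum_const, card_range,
        nsmul_eq_mul]
      push_cast
      rfl
    rw [hsum, pow_add, sum_range_mul]
    simp only [hblock]
    have h3 : ∑ u ∈ range (2 ^ k), (d (2 ^ j * (u + 1)) - d (2 ^ j * u)) ^ 2 ≤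
        4 * ∑ u ∈ range (2 ^ k), d (2 ^ j * u) ^ 2 := by
      have h4 := sum_shift_le (g := fun u => d (2 ^ j * u) ^ 2) (P := 2 ^ k)
        (fun u => sq_nonneg _) (fun u hu => hP2 _ (by rw [pow_add]; exact Nat.mul_le_mul_left _ hu)) 1
      calc _ ≤ ∑ u ∈ range (2 ^ k), (2 * d (2 ^ j * (u + 1)) ^ 2 + 2 * d (2 ^ j * u) ^ 2) :=
            sum_le_sum fun x _ => by
              nlinarith [sq_nonneg (d (2 ^ j * (x + 1)) + d (2 ^ j * x))]
        _ ≤ _ := by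
            rw [sum_add_distrib, ← mul_sum, ← mul_sum]
            linarith
    rw [← mul_sum]
    calc (2 : ℝ) ^ j * (m * ∑ u ∈ range (2 ^ k), (d (2 ^ j * (u + 1)) - d (2 ^ j * u)) ^ 2)
        ≤ 2 ^ j * (m * (4 * ∑ u ∈ range (2 ^ k), d (2 ^ j * u) ^ 2)) := by gcongr
      _ = _ := by ring

lemma fwdAvg_sub {f : ℕ → ℝ} {n : ℕ} (hn : 1 ≤ n) (x : ℕ) :
    fwdAvg f n x - f x = (∑ m ∈ range n, (f (x + m) - f x)) / n := by
  rw [fwdAvg, sum_sub_distrib, sum_const, card_range, nsmul_eq_mul]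
  field_simp

lemma sum_sq_fwdAvg_sub_le {j J : ℕ} (hj : j ≤ J) {d : ℕ → ℝ} (hd : BlockConst (2 ^ j) d)
    (hP : ∀ x, 2 ^ J ≤ x → d x = 0) {n : ℕ} (hn : 1 ≤ n) :
    2 ^ j * ∑ x ∈ range (2 ^ J), (fwdAvg d n x - d x) ^ 2 ≤
      4 * n * ∑ x ∈ range (2 ^ J), d x ^ 2 := by
  have hn0 : (0 : ℝ) < n := by exact_mod_cast hn
  have h1 : ∑ x ∈ range (2 ^ J), (fwdAvg d n x - d x) ^ 2 ≤
      (∑ m ∈ range n, ∑ x ∈ range (2 ^ J), (d (x + m) - d x) ^ 2) / n := by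
    rw [sum_comm, sum_div]
    refine sum_le_sum fun x _ => ?_
    have := sq_sum_le_card_mul_sum_sq (s := range n) (f := fun m => d (x + m) - d x)
    rw [card_range] at this
    rw [fwdAvg_sub hn, div_pow, div_le_div_iff₀ (by positivity) hn0]
    nlinarith
  have hN : 0 ≤ ∑ x ∈ range (2 ^ J), d x ^ 2 := sum_nonneg fun _ _ => sq_nonneg _
  calc _ ≤ 2 ^ j * ((∑ m ∈ range n, ∑ x ∈ range (2 ^ J), (d (x + m) - d x) ^ 2) / n) := by gcongr
    _ = (∑ m ∈ range n, 2 ^ j * ∑ x ∈ range (2 ^ J), (d (x + m) - d x) ^ 2) / n := by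
        rw [← mul_sum]; ring
    _ ≤ (∑ m ∈ range n, 4 * n * ∑ x ∈ range (2 ^ J), d x ^ 2) / n := by
        refine div_le_div_of_nonneg_right (sum_le_sum fun m hm => ?_) hn0.le
        refine (sum_sq_shift_sub_le hj hd hP m).trans ?_
        have : (m : ℝ) ≤ n := by exact_mod_cast (mem_range.1 hm).le
        gcongr
    _ = _ := by
        rw [sum_const, card_range, nsmul_eq_mul]
        field_simp

/-- Partial sums restart from zero at each block boundary, so Cauchy-Schwarz within one block bounds
them. -/
lemma sum_sq_prefix_le {i J : ℕ} (hi : i ≤ J) {d : ℕ → ℝ}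
    (h0 : ∀ u, ∑ y ∈ range (2 ^ i * u), d y = 0) :
    ∑ x ∈ range (2 ^ J), (∑ y ∈ range x, d y) ^ 2 ≤
      2 ^ (2 * i) * ∑ x ∈ range (2 ^ J), d x ^ 2 := by
  obtain ⟨k, rfl⟩ := Nat.exists_eq_add_of_le hi
  rw [pow_add, sum_range_mul, sum_range_mul, mul_sum]
  refine sum_le_sum fun u _ => ?_
  have hv : ∀ v ∈ range (2 ^ i), (∑ y ∈ range (2 ^ i * u + v), d y) ^ 2 ≤
      2 ^ i * ∑ v ∈ range (2 ^ i), d (2 ^ i * u + v) ^ 2 := by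
    intro v hv
    rw [sum_range_add, h0, zero_add]
    have h1 := sq_sum_le_card_mul_sum_sq (s := range v) (f := fun m => d (2 ^ i * u + m))
    rw [card_range] at h1
    refine h1.trans ?_
    have hv := (mem_range.1 hv).le
    have : (v : ℝ) ≤ 2 ^ i := by exact_mod_cast hv
    have h2 : ∑ m ∈ range v, d (2 ^ i * u + m) ^ 2 ≤ ∑ m ∈ range (2 ^ i), d (2 ^ i * u + m) ^ 2 :=
      sum_le_sum_of_subset_of_nonneg (range_mono hv) fun _ _ _ => sq_nonneg _
    have h3 : 0 ≤ ∑ m ∈ range v, d (2 ^ i * u + m) ^ 2 := sum_nonneg fun _ _ => sq_nonneg _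
    gcongr
  refine (sum_le_sum hv).trans (le_of_eq ?_)
  rw [sum_const, card_range, nsmul_eq_mul]
  push_cast
  ring

/-- $nA_nd(x)$ is a difference of two partial sums of $d$: cancellation in the blocks gives the gain
$(2^i/n)^2$. -/
lemma sum_sq_fwdAvg_le {i J : ℕ} (hi : i ≤ J) {d : ℕ → ℝ} (hP : ∀ x, 2 ^ J ≤ x → d x = 0)
    (h0 : ∀ u, ∑ y ∈ range (2 ^ i * u), d y = 0) {n : ℕ} (hn : 1 ≤ n) :
    (n : ℝ) ^ 2 * ∑ x ∈ range (2 ^ J), fwdAvg d n x ^ 2 ≤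
      4 * 2 ^ (2 * i) * ∑ x ∈ range (2 ^ J), d x ^ 2 := by
  set S : ℕ → ℝ := fun x => ∑ y ∈ range x, d y with hS
  have hn0 : (0 : ℝ) < n := by exact_mod_cast hn
  have hA : ∀ x, (n : ℝ) ^ 2 * fwdAvg d n x ^ 2 = (S (x + n) - S x) ^ 2 := by
    intro x
    simp only [hS, sum_range_add, add_sub_cancel_left, fwdAvg]
    field_simp
  have hSP : ∀ x, 2 ^ J ≤ x → S x ^ 2 = 0 := by
    intro x hx
    obtain ⟨k, rfl⟩ := Nat.exists_eq_add_of_le hx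
    obtain ⟨l, rfl⟩ := Nat.exists_eq_add_of_le hi
    have h1 := h0 (2 ^ l)
    rw [← pow_add] at h1
    simp only [hS, sum_range_add, h1]
    rw [sum_eq_zero fun y _ => hP _ (Nat.le_add_right _ _)]
    norm_num
  rw [mul_sum]
  simp only [hA]
  have h4 := sum_shift_le (fun x => sq_nonneg (S x)) hSP n
  have h5 := sum_sq_prefix_le hi h0
  calc _ ≤ ∑ x ∈ range (2 ^ J), (2 * S (x + n) ^ 2 + 2 * S x ^ 2) :=
        sum_le_sum fun x _ => by nlinarith [sq_nonneg (S (x + n) + S x)]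
    _ ≤ _ := by
        rw [sum_add_distrib, ← mul_sum, ← mul_sum]
        simp only [hS] at h4 ⊢
        linarith

lemma fwdAvg_succ_sub (f : ℕ → ℝ) {n : ℕ} (hn : 1 ≤ n) (x : ℕ) :
    (n + 1) * (fwdAvg f (n + 1) x - fwdAvg f n x) = f (x + n) - fwdAvg f n x := by
  have hn0 : (n : ℝ) ≠ 0 := by positivity
  simp only [fwdAvg, sum_range_succ]
  push_cast
  field_simp
  ring

/-! ### Variation of a real path -/

/-- `∑_{i ∈ [m, n)} |c (i + 1) - c i| (|c i| + |c (i + 1)|)`, which bounds the variation of the path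
`c |c|` on `[m, n]`. -/
def sqVar (c : ℕ → ℝ) (m n : ℕ) : ℝ := ∑ i ∈ Ico m n, |c (i + 1) - c i| * (|c i| + |c (i + 1)|)

lemma sqVar_nonneg (c : ℕ → ℝ) (m n : ℕ) : 0 ≤ sqVar c m n := sum_nonneg fun _ _ => by positivity

lemma sqVar_mono (c : ℕ → ℝ) {m m' n n' : ℕ} (h : m' ≤ m) (h' : n ≤ n') :
    sqVar c m n ≤ sqVar c m' n' :=
  sum_le_sum_of_subset_of_nonneg (Ico_subset_Ico h h') fun _ _ _ => by positivity

/-- The signed square `x |x|`. -/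
def signedSq (x : ℝ) : ℝ := x * |x|

lemma abs_signedSq_sub_le (x y : ℝ) : |signedSq y - signedSq x| ≤ |y - x| * (|x| + |y|) := by
  have h : signedSq y - signedSq x = (y - x) * |y| + x * (|y| - |x|) := by
    simp only [signedSq]; ring
  rw [h]
  refine (abs_add_le _ _).trans ?_
  rw [abs_mul, abs_mul, abs_abs]
  have := mul_le_mul_of_nonneg_left (abs_abs_sub_abs_le y x) (abs_nonneg x)
  linarith

/-- For equal signs $(y-x)^2\le|y^2-x^2|$; for opposite signs $(y-x)^2\le2(x^2+y^2)$. Thus squared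
increments are dominated by the variation of $c|c|$, which is additive over intervals of time. -/
lemma sq_sub_le_two_mul (x y : ℝ) : (y - x) ^ 2 ≤ 2 * |signedSq y - signedSq x| := by
  have h1 := le_abs_self (signedSq y - signedSq x)
  have h2 := neg_le_abs (signedSq y - signedSq x)
  generalize |signedSq y - signedSq x| = A at h1 h2
  simp only [signedSq] at h1 h2
  rcases abs_cases x with ⟨hx, _⟩ | ⟨hx, _⟩ <;> rcases abs_cases y with ⟨hy, _⟩ | ⟨hy, _⟩ <;>
    rw [hx, hy] at h1 h2
  · rcases le_total x y with h | h <;> nlinarith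
  · nlinarith [sq_nonneg (x + y)]
  · nlinarith [sq_nonneg (x + y)]
  · rcases le_total x y with h | h <;> nlinarith

lemma abs_signedSq_sub_le_sqVar (c : ℕ → ℝ) {m n : ℕ} (h : m ≤ n) :
    |signedSq (c n) - signedSq (c m)| ≤ sqVar c m n := by
  rw [← sum_Ico_sub (fun i => signedSq (c i)) h]
  exact (abs_sum_le_sum_abs _ _).trans (sum_le_sum fun i _ => abs_signedSq_sub_le _ _)

lemma sq_sub_le_sqVar (c : ℕ → ℝ) {m n : ℕ} (h : m ≤ n) : (c n - c m) ^ 2 ≤ 2 * sqVar c m n :=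
  (sq_sub_le_two_mul _ _).trans (by linarith [abs_signedSq_sub_le_sqVar c h])

lemma sq_le_sq_add_sqVar (c : ℕ → ℝ) {m n : ℕ} (h : m ≤ n) :
    c n ^ 2 ≤ c m ^ 2 + sqVar c m n := by
  have h1 := (abs_abs_sub_abs_le (signedSq (c n)) (signedSq (c m))).trans
    (abs_signedSq_sub_le_sqVar c h)
  have h2 := (le_abs_self _).trans h1
  simp only [signedSq, abs_mul, abs_abs, abs_mul_abs_self] at h2
  nlinarith

/-- AM-GM with a free parameter. The useful choice is $\alpha\approx\sqrt{B/D}$, which makes each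
step cost about $\sqrt{BD}$. -/
lemma sum_sqVar_le {b : ℕ → ℕ → ℝ} {m n P : ℕ} {B D α : ℝ} (hα : 0 < α)
    (hB : ∀ i ∈ Icc m n, ∑ x ∈ range P, b i x ^ 2 ≤ B)
    (hD : ∀ i ∈ Ico m n, ∑ x ∈ range P, (b (i + 1) x - b i x) ^ 2 ≤ D) :
    ∑ x ∈ range P, sqVar (fun i => b i x) m n ≤ ((n - m : ℕ) : ℝ) * (α * D + B / α) := by
  simp only [sqVar]
  rw [sum_comm]
  calc _ ≤ ∑ i ∈ Ico m n, (α * D + B / α) := sum_le_sum fun i hi => ?_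
    _ = _ := by rw [sum_const, Nat.card_Ico, nsmul_eq_mul]
  have hi' := mem_Ico.1 hi
  have h1 := hB i (mem_Icc.2 ⟨hi'.1, hi'.2.le⟩)
  have h2 := hB (i + 1) (mem_Icc.2 ⟨by omega, hi'.2⟩)
  have h3 := hD i hi
  calc _ ≤ ∑ x ∈ range P, (α * (b (i + 1) x - b i x) ^ 2 +
        ((2 * α)⁻¹ * b i x ^ 2 + (2 * α)⁻¹ * b (i + 1) x ^ 2)) := sum_le_sum fun x _ => ?_
    _ ≤ _ := by
        rw [sum_add_distrib, sum_add_distrib, ← mul_sum, ← mul_sum, ← mul_sum]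
        have h4 := mul_le_mul_of_nonneg_left h1 (show 0 ≤ (2 * α)⁻¹ by positivity)
        have h5 := mul_le_mul_of_nonneg_left h2 (show 0 ≤ (2 * α)⁻¹ by positivity)
        have h6 := mul_le_mul_of_nonneg_left h3 hα.le
        have h7 : B / α = (2 * α)⁻¹ * B + (2 * α)⁻¹ * B := by field_simp; ring
        linarith
  have key : ∀ u v : ℝ, u * v ≤ α / 2 * u ^ 2 + (2 * α)⁻¹ * v ^ 2 := by
    intro u v
    have : α / 2 * u ^ 2 + (2 * α)⁻¹ * v ^ 2 - u * v = (2 * α)⁻¹ * (α * u - v) ^ 2 := by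
      field_simp; ring
    have h0 : 0 ≤ (2 * α)⁻¹ * (α * u - v) ^ 2 := by positivity
    linarith
  have k1 := key |b (i + 1) x - b i x| |b i x|
  have k2 := key |b (i + 1) x - b i x| |b (i + 1) x|
  simp only [sq_abs] at k1 k2
  rw [mul_add]
  linarith

/-! ### Averages of a single dyadic difference over a single dyadic block of times -/

/-- The average of `d` at time `n`, corrected by `d` itself when the scale `j` of `d` is at least
`p`. -/
noncomputable def blockErr (p j : ℕ) (d : ℕ → ℝ) (n x : ℕ) : ℝ :=
  fwdAvg d n x - if p ≤ j then d x else 0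

/-- A bound for the size and the variation of `blockErr` over the times in `[2 ^ p, 2 ^ (p + 1)]`. -/
noncomputable def blockVar (p j : ℕ) (d : ℕ → ℝ) (x : ℕ) : ℝ :=
  blockErr p j d (2 ^ p) x ^ 2 + sqVar (fun i => blockErr p j d i x) (2 ^ p) (2 ^ (p + 1))

lemma sum_blockVar_le_of_bounds {p j P : ℕ} {d : ℕ → ℝ} {B D α : ℝ} (hα : 0 < α)
    (hB : ∀ i ∈ Icc (2 ^ p) (2 ^ (p + 1)), ∑ x ∈ range P, blockErr p j d i x ^ 2 ≤ B)
    (hD : ∀ i ∈ Ico (2 ^ p) (2 ^ (p + 1)),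
      ∑ x ∈ range P, (blockErr p j d (i + 1) x - blockErr p j d i x) ^ 2 ≤ D) :
    ∑ x ∈ range P, blockVar p j d x ≤ B + 2 ^ p * (α * D + B / α) := by
  simp only [blockVar]
  rw [sum_add_distrib]
  have h1 := hB (2 ^ p) (mem_Icc.2 ⟨le_rfl, Nat.pow_le_pow_right (by norm_num) (by omega)⟩)
  have h2 := sum_sqVar_le hα hB hD
  have h3 : ((2 ^ (p + 1) - 2 ^ p : ℕ) : ℝ) = 2 ^ p := by
    rw [pow_succ, show 2 ^ p * 2 - 2 ^ p = 2 ^ p by omega]; norm_num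
  rw [h3] at h2
  linarith

lemma sum_blockVar_le_coarse {p j J : ℕ} (hpj : p ≤ j) (hj : j ≤ J) {d : ℕ → ℝ}
    (hd : BlockConst (2 ^ j) d) (hP : ∀ x, 2 ^ J ≤ x → d x = 0) :
    ∑ x ∈ range (2 ^ J), blockVar p j d x ≤
      56 * (1 / 2) ^ (p - j + (j - p)) * ∑ x ∈ range (2 ^ J), d x ^ 2 := by
  have hN : 0 ≤ ∑ x ∈ range (2 ^ J), d x ^ 2 := sum_nonneg fun _ _ => sq_nonneg _
  obtain ⟨k, rfl⟩ := Nat.exists_eq_add_of_le hpj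
  rw [show p - (p + k) + (p + k - p) = k by omega]
  have hρ : ((1 : ℝ) / 2) ^ k * 2 ^ k = 1 := by rw [← mul_pow]; norm_num
  set ρ : ℝ := (1 / 2) ^ k
  have hρ0 : 0 ≤ ρ := by positivity
  set N := ∑ x ∈ range (2 ^ J), d x ^ 2
  have h2p : (0 : ℝ) < 2 ^ p := by positivity
  have h2k : (0 : ℝ) < 2 ^ k := by positivity
  have scale : ∀ X : ℝ, ∀ i : ℕ, i ≤ 2 ^ (p + 1) → 2 ^ (p + k) * X ≤ 4 * i * N → X ≤ 8 * ρ * N := by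
    intro X i hi h
    have hi' : (i : ℝ) ≤ 2 * 2 ^ p := by
      have : (i : ℝ) ≤ 2 ^ (p + 1) := by exact_mod_cast hi
      rwa [pow_succ, mul_comm] at this
    have h1 : 2 ^ (p + k) * X ≤ 4 * (2 * 2 ^ p) * N := h.trans (by gcongr)
    rw [pow_add, mul_assoc] at h1
    have h2 : 2 ^ k * X ≤ 8 * N := by
      refine le_of_mul_le_mul_left (h1.trans (le_of_eq ?_)) h2p
      ring
    calc X = ρ * (2 ^ k * X) := by rw [← mul_assoc, hρ, one_mul]
      _ ≤ ρ * (8 * N) := by gcongr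
      _ = _ := by ring
  have hB : ∀ i ∈ Icc (2 ^ p) (2 ^ (p + 1)),
      ∑ x ∈ range (2 ^ J), blockErr p (p + k) d i x ^ 2 ≤ 8 * ρ * N := by
    intro i hi
    have hi := mem_Icc.1 hi
    have hi1 : 1 ≤ i := Nat.one_le_two_pow.trans hi.1
    simp only [blockErr, if_pos hpj]
    exact scale _ i hi.2 (sum_sq_fwdAvg_sub_le hj hd hP hi1)
  -- The increment is $(d(x+i)-d(x)-\text{error})/(i+1)$, and both squared terms have energy at most
  -- $8\rho N$. Taking $\alpha=2^p$ gives $8+32+8=48$ times $\rho N$; the constant 56 is only a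
  -- common bound for the two regimes.
  refine (sum_blockVar_le_of_bounds (D := 32 * ρ * N / (2 ^ p) ^ 2) h2p hB ?_).trans
    (le_of_eq_of_le (b := 48 * ρ * N) ?_ ?_)
  · intro i hi
    have hi := mem_Ico.1 hi
    have hi1 : 1 ≤ i := Nat.one_le_two_pow.trans hi.1
    have hB' := hB i (mem_Icc.2 ⟨hi.1, hi.2.le⟩)
    have hS := scale _ i hi.2.le (sum_sq_shift_sub_le hj hd hP i)
    have hip : (2 : ℝ) ^ p ≤ i + 1 := by
      have : (2 : ℝ) ^ p ≤ i := by exact_mod_cast hi.1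
      linarith
    rw [le_div_iff₀ (by positivity), sum_mul]
    calc _ ≤ ∑ x ∈ range (2 ^ J),
          (2 * (d (x + i) - d x) ^ 2 + 2 * blockErr p (p + k) d i x ^ 2) := by
          refine sum_le_sum fun x _ => ?_
          have h1 := fwdAvg_succ_sub d hi1 x
          have h2 : blockErr p (p + k) d (i + 1) x - blockErr p (p + k) d i x =
              fwdAvg d (i + 1) x - fwdAvg d i x := by simp [blockErr]
          rw [h2]
          calc _ ≤ (fwdAvg d (i + 1) x - fwdAvg d i x) ^ 2 * ((i : ℝ) + 1) ^ 2 := by gcongr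
            _ = (d (x + i) - d x - blockErr p (p + k) d i x) ^ 2 := by
                rw [← mul_pow, mul_comm, h1, blockErr, if_pos hpj]; ring
            _ ≤ _ := by nlinarith [sq_nonneg (d (x + i) - d x + blockErr p (p + k) d i x)]
      _ ≤ _ := by
          rw [sum_add_distrib, ← mul_sum, ← mul_sum]
          linarith
  · field_simp
    ring
  · have := mul_nonneg hρ0 hN
    linarith

lemma sum_blockVar_le_fine {p j J : ℕ} (hpj : j < p) (hj : j < J) {d : ℕ → ℝ}
    (hP : ∀ x, 2 ^ J ≤ x → d x = 0) (h0 : ∀ u, ∑ y ∈ range (2 ^ (j + 1) * u), d y = 0) :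
    ∑ x ∈ range (2 ^ J), blockVar p j d x ≤
      56 * (1 / 2) ^ (p - j + (j - p)) * ∑ x ∈ range (2 ^ J), d x ^ 2 := by
  have hN : 0 ≤ ∑ x ∈ range (2 ^ J), d x ^ 2 := sum_nonneg fun _ _ => sq_nonneg _
  obtain ⟨k, rfl⟩ := Nat.exists_eq_add_of_le hpj.le
  rw [show j + k - j + (j - (j + k)) = k by omega]
  have hρ : ((1 : ℝ) / 2) ^ k * 2 ^ k = 1 := by rw [← mul_pow]; norm_num
  have hρ1 : ((1 : ℝ) / 2) ^ k ≤ 1 / 2 := by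
    have := pow_le_pow_of_le_one (by norm_num : (0 : ℝ) ≤ 1 / 2) (by norm_num)
      (show 1 ≤ k by omega)
    simpa using this
  set ρ : ℝ := (1 / 2) ^ k
  have hρ0 : 0 ≤ ρ := by positivity
  set N := ∑ x ∈ range (2 ^ J), d x ^ 2
  have h2j : (0 : ℝ) < 2 ^ j := by positivity
  have h2p : (0 : ℝ) < 2 ^ (j + k) := by positivity
  have hρp : ρ * 2 ^ (j + k) = 2 ^ j := by rw [pow_add, mul_left_comm, hρ, mul_one]
  have hB : ∀ i ∈ Icc (2 ^ (j + k)) (2 ^ (j + k + 1)),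
      ∑ x ∈ range (2 ^ J), blockErr (j + k) j d i x ^ 2 ≤ 16 * ρ ^ 2 * N := by
    intro i hi
    have hi := mem_Icc.1 hi
    have hi1 : 1 ≤ i := Nat.one_le_two_pow.trans hi.1
    simp only [blockErr, if_neg (not_le.2 hpj), sub_zero]
    have h1 := sum_sq_fwdAvg_le (Nat.succ_le_of_lt hj) hP h0 hi1
    have hip : (2 : ℝ) ^ (j + k) ≤ i := by exact_mod_cast hi.1
    have hS : 0 ≤ ∑ x ∈ range (2 ^ J), fwdAvg d i x ^ 2 := sum_nonneg fun _ _ => sq_nonneg _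
    have h2 : ((2 : ℝ) ^ (j + k)) ^ 2 * ∑ x ∈ range (2 ^ J), fwdAvg d i x ^ 2 ≤
        ((2 : ℝ) ^ (j + k)) ^ 2 * (16 * ρ ^ 2 * N) := by
      calc _ ≤ (i : ℝ) ^ 2 * ∑ x ∈ range (2 ^ J), fwdAvg d i x ^ 2 := by gcongr
        _ ≤ _ := h1
        _ = 16 * (2 ^ j) ^ 2 * N := by rw [Nat.succ_eq_add_one]; ring
        _ = _ := by rw [← hρp]; ring
    exact le_of_mul_le_mul_left h2 (by positivity)
  have hP2 : ∀ x, 2 ^ J ≤ x → d x ^ 2 = 0 := fun x hx => by rw [hP x hx]; norm_num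
  -- Here the size gains $\rho^2$ but the increments gain nothing beyond $1/i$, so
  -- $\alpha=2^j=\rho2^p$ and the product is of order $\rho$. The 10 is $2+32\rho^2$ with
  -- $\rho\le1/2$, which is where $j<p$ is strict.
  refine (sum_blockVar_le_of_bounds (D := 10 * N / (2 ^ (j + k)) ^ 2) h2j hB ?_).trans
    (le_of_eq_of_le (b := 16 * ρ ^ 2 * N + 26 * ρ * N) ?_ ?_)
  · intro i hi
    have hi := mem_Ico.1 hi
    have hi1 : 1 ≤ i := Nat.one_le_two_pow.trans hi.1
    have hB' := hB i (mem_Icc.2 ⟨hi.1, hi.2.le⟩)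
    have hS := sum_shift_le (fun x => sq_nonneg (d x)) hP2 i
    have hip : (2 : ℝ) ^ (j + k) ≤ i + 1 := by
      have : (2 : ℝ) ^ (j + k) ≤ i := by exact_mod_cast hi.1
      linarith
    rw [le_div_iff₀ (by positivity), sum_mul]
    calc _ ≤ ∑ x ∈ range (2 ^ J),
          (2 * d (x + i) ^ 2 + 2 * blockErr (j + k) j d i x ^ 2) := by
          refine sum_le_sum fun x _ => ?_
          have h1 := fwdAvg_succ_sub d hi1 x
          have h2 : blockErr (j + k) j d (i + 1) x - blockErr (j + k) j d i x =
              fwdAvg d (i + 1) x - fwdAvg d i x := by simp [blockErr]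
          rw [h2]
          calc _ ≤ (fwdAvg d (i + 1) x - fwdAvg d i x) ^ 2 * ((i : ℝ) + 1) ^ 2 := by gcongr
            _ = (d (x + i) - blockErr (j + k) j d i x) ^ 2 := by
                rw [← mul_pow, mul_comm, h1, blockErr, if_neg (not_le.2 hpj), sub_zero]
            _ ≤ _ := by nlinarith [sq_nonneg (d (x + i) + blockErr (j + k) j d i x)]
      _ ≤ _ := by
          rw [sum_add_distrib, ← mul_sum, ← mul_sum]
          have : ρ ^ 2 * N ≤ (1 / 2) ^ 2 * N := by gcongr
          linarith
  · rw [← hρp]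
    have hρ' : ρ ≠ 0 := by positivity
    field_simp
    ring
  · have h1 := mul_nonneg hρ0 hN
    have h2 : ρ * (ρ * N) ≤ 1 / 2 * (ρ * N) := by gcongr
    nlinarith

/-! ### Dyadic martingale differences -/

/-- The dyadic means up to scale `J`, continued by `0`. -/
noncomputable def dyTrunc (J : ℕ) (f : ℕ → ℝ) (j x : ℕ) : ℝ := if j ≤ J then dyMean j f x else 0

/-- The dyadic martingale differences; the one of index `J` is the mean at scale `J` itself. -/
noncomputable def dyDiff (J : ℕ) (f : ℕ → ℝ) (j x : ℕ) : ℝ := dyTrunc J f j x - dyTrunc J f (j + 1) x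

lemma blockConst_dyDiff (J j : ℕ) (f : ℕ → ℝ) :
    BlockConst (2 ^ j) (dyDiff J f j) := by
  have h1 := (blockConst_dyMean (j + 1) f).of_dvd (pow_dvd_pow 2 (Nat.le_succ j))
  exact (blockConst_dyMean j f).comp₂ h1
    fun u v => (if j ≤ J then u else 0) - (if j + 1 ≤ J then v else 0)

lemma dyTrunc_eq_zero {J : ℕ} {f : ℕ → ℝ} (hf : ∀ x, 2 ^ J ≤ x → f x = 0) (j : ℕ) {x : ℕ}
    (hx : 2 ^ J ≤ x) : dyTrunc J f j x = 0 := by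
  rw [dyTrunc]
  split_ifs with h
  · exact dyMean_eq_zero h hf hx
  · rfl

lemma dyDiff_eq_zero {J : ℕ} {f : ℕ → ℝ} (hf : ∀ x, 2 ^ J ≤ x → f x = 0) (j : ℕ) {x : ℕ}
    (hx : 2 ^ J ≤ x) : dyDiff J f j x = 0 := by
  rw [dyDiff, dyTrunc_eq_zero hf _ hx, dyTrunc_eq_zero hf _ hx, sub_zero]

lemma sum_prefix_dyDiff {J j : ℕ} (f : ℕ → ℝ) (hj : j < J) (u : ℕ) :
    ∑ y ∈ range (2 ^ (j + 1) * u), dyDiff J f j y = 0 := by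
  have hone : ∀ l, BlockConst l fun _ => 1 := fun _ _ _ _ => rfl
  have h1 := sum_mul_dyMean (Q := u) (hone (2 ^ (j + 1))) f
  have h2 := sum_mul_dyMean (Q := 2 * u) (hone (2 ^ j)) f
  rw [show 2 ^ j * (2 * u) = 2 ^ (j + 1) * u by ring] at h2
  simp only [one_mul] at h1 h2
  simp only [dyDiff, dyTrunc, if_pos hj.le, if_pos (Nat.succ_le_of_lt hj), sum_sub_distrib, h1, h2,
    sub_self]

lemma sum_sum_sq_dyDiff (J : ℕ) (f : ℕ → ℝ) :
    ∑ j ∈ range (J + 1), ∑ x ∈ range (2 ^ J), dyDiff J f j x ^ 2 =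
      ∑ x ∈ range (2 ^ J), f x ^ 2 := by
  have h : ∀ j ∈ range (J + 1), ∑ x ∈ range (2 ^ J), dyDiff J f j x ^ 2 =
      ∑ x ∈ range (2 ^ J), dyTrunc J f j x ^ 2 - ∑ x ∈ range (2 ^ J), dyTrunc J f (j + 1) x ^ 2 := by
    intro j hj
    rcases Nat.lt_succ_iff_lt_or_eq.1 (mem_range.1 hj) with h | rfl
    · simp only [dyDiff, dyTrunc, if_pos h.le, if_pos (Nat.succ_le_of_lt h)]
      exact sum_sq_dyMean_sub (Nat.le_succ j) h f
    · simp [dyDiff, dyTrunc]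
  rw [sum_congr rfl h, sum_range_sub' fun j => ∑ x ∈ range (2 ^ J), dyTrunc J f j x ^ 2]
  simp [dyTrunc, dyMean_zero]

lemma sum_dyDiff_Ico {J p : ℕ} (hp : p ≤ J) (f : ℕ → ℝ) (x : ℕ) :
    ∑ j ∈ Ico p (J + 1), dyDiff J f j x = dyMean p f x := by
  have h := sum_Ico_sub (fun j => -dyTrunc J f j x) (show p ≤ J + 1 by omega)
  have h2 : ∀ j, dyDiff J f j x = -dyTrunc J f (j + 1) x - -dyTrunc J f j x := fun j => by
    rw [dyDiff]; ring
  simp only [h2, h]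
  simp [dyTrunc, hp]

lemma fwdAvg_sum {ι : Type*} (s : Finset ι) (F : ι → ℕ → ℝ) (n x : ℕ) :
    fwdAvg (fun y => ∑ j ∈ s, F j y) n x = ∑ j ∈ s, fwdAvg (F j) n x := by
  simp only [fwdAvg]
  rw [sum_comm, sum_div]

/-- The differences add up to $f$, and those subtracted as corrections, with $j\ge p$, add up to
$E_pf$. -/
lemma sum_blockErr {J p : ℕ} (hp : p ≤ J) (f : ℕ → ℝ) (n x : ℕ) :
    ∑ j ∈ range (J + 1), blockErr p j (dyDiff J f j) n x = fwdAvg f n x - dyMean p f x := by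
  simp only [blockErr]
  rw [sum_sub_distrib, ← fwdAvg_sum, ← sum_filter]
  have h1 : (fun y => ∑ j ∈ range (J + 1), dyDiff J f j y) = f := by
    ext y
    rw [range_eq_Ico, sum_dyDiff_Ico (Nat.zero_le J), dyMean_zero]
  have h2 : (range (J + 1)).filter (fun j => p ≤ j) = Ico p (J + 1) := by
    ext j; simp only [mem_filter, mem_range, mem_Ico]; omega
  rw [h1, h2, sum_dyDiff_Ico hp]

/-! ### Summation over scales -/

lemma sum_geom_dist_le {r : ℝ} (h0 : 0 ≤ r) (h1 : r < 1) (p K : ℕ) :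
    ∑ j ∈ range K, r ^ (p - j + (j - p)) ≤ 2 / (1 - r) := by
  have hg : ∀ n, ∑ i ∈ range n, r ^ i ≤ 1 / (1 - r) := fun n => by
    rw [one_div, ← tsum_geometric_of_lt_one h0 h1]
    exact (summable_geometric_of_lt_one h0 h1).sum_le_tsum _ fun _ _ => by positivity
  calc ∑ j ∈ range K, r ^ (p - j + (j - p))
      ≤ ∑ j ∈ range ((p + 1) + K), r ^ (p - j + (j - p)) :=
        sum_le_sum_of_subset_of_nonneg (range_mono (by omega)) fun _ _ _ => by positivity
    _ = ∑ j ∈ range (p + 1), r ^ j + ∑ j ∈ range K, r * r ^ j := by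
        rw [sum_range_add, ← sum_range_reflect (fun j => r ^ j)]
        congr 1
        · refine sum_congr rfl fun j hj => ?_
          have := mem_range.1 hj
          congr 1; omega
        · refine sum_congr rfl fun j _ => ?_
          rw [← pow_succ']
          congr 1; omega
    _ ≤ 1 / (1 - r) + 1 * (1 / (1 - r)) := by
        rw [← mul_sum]
        have := hg K
        have := hg (p + 1)
        gcongr
    _ = 2 / (1 - r) := by ring

/-- The weight attached to a pair of scales. -/
noncomputable def scaleWeight (p j : ℕ) : ℝ := (3 / 4) ^ (p - j + (j - p))

lemma scaleWeight_pos (p j : ℕ) : 0 < scaleWeight p j := by unfold scaleWeight; positivity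

/-- Cauchy-Schwarz with weights of total mass at most $2/(1-3/4)=8$. Any ratio strictly between
$1/2$ and $1$ would serve: the weights stay summable and dividing by them preserves decay. -/
lemma sq_sum_le_sum_div_scaleWeight (p K : ℕ) (b : ℕ → ℝ) :
    (∑ j ∈ range K, b j) ^ 2 ≤ 8 * ∑ j ∈ range K, b j ^ 2 / scaleWeight p j := by
  have h1 : ∑ j ∈ range K, scaleWeight p j ≤ 8 :=
    (sum_geom_dist_le (by norm_num) (by norm_num) p K).trans (by norm_num)
  have h2 := sum_sq_le_sum_mul_sum_of_sq_le_mul (range K) (r := b)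
    (f := fun j => scaleWeight p j) (g := fun j => b j ^ 2 / scaleWeight p j)
    (fun j _ => (scaleWeight_pos p j).le)
    (fun j _ => div_nonneg (sq_nonneg _) (scaleWeight_pos p j).le)
    (fun j _ => le_of_eq (by have := (scaleWeight_pos p j).ne'; field_simp))
  refine h2.trans (mul_le_mul_of_nonneg_right h1 ?_)
  exact sum_nonneg fun j _ => div_nonneg (sq_nonneg _) (scaleWeight_pos p j).le

/-- The weighted sum over all scales of the bounds `blockVar`. -/
noncomputable def totalVar (J : ℕ) (f : ℕ → ℝ) (p x : ℕ) : ℝ :=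
  ∑ j ∈ range (J + 1), blockVar p j (dyDiff J f j) x / scaleWeight p j

/-- The weighted sum over all scales of the contribution of the time step from `i` to `i + 1`. -/
noncomputable def stepVar (J : ℕ) (f : ℕ → ℝ) (p i x : ℕ) : ℝ :=
  ∑ j ∈ range (J + 1), sqVar (fun i => blockErr p j (dyDiff J f j) i x) i (i + 1) / scaleWeight p j

lemma sqVar_eq_sum (c : ℕ → ℝ) (m n : ℕ) : sqVar c m n = ∑ i ∈ Ico m n, sqVar c i (i + 1) := by
  simp [sqVar]

lemma stepVar_nonneg (J : ℕ) (f : ℕ → ℝ) (p i x : ℕ) : 0 ≤ stepVar J f p i x :=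
  sum_nonneg fun j _ => div_nonneg (sqVar_nonneg _ _ _) (scaleWeight_pos p j).le

lemma blockVar_nonneg (p j : ℕ) (d : ℕ → ℝ) (x : ℕ) : 0 ≤ blockVar p j d x :=
  add_nonneg (sq_nonneg _) (sqVar_nonneg _ _ _)

lemma totalVar_nonneg (J : ℕ) (f : ℕ → ℝ) (p x : ℕ) : 0 ≤ totalVar J f p x :=
  sum_nonneg fun j _ => div_nonneg (blockVar_nonneg _ _ _ _) (scaleWeight_pos p j).le

lemma sum_stepVar (J : ℕ) (f : ℕ → ℝ) (p m n x : ℕ) :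
    ∑ i ∈ Ico m n, stepVar J f p i x =
      ∑ j ∈ range (J + 1),
        sqVar (fun i => blockErr p j (dyDiff J f j) i x) m n / scaleWeight p j := by
  simp only [stepVar]
  rw [sum_comm]
  refine sum_congr rfl fun j _ => ?_
  rw [← sum_div, ← sqVar_eq_sum]

lemma sum_stepVar_le_totalVar (J : ℕ) (f : ℕ → ℝ) (p x : ℕ) :
    ∑ i ∈ Ico (2 ^ p) (2 ^ (p + 1)), stepVar J f p i x ≤ totalVar J f p x := by
  rw [sum_stepVar]
  refine sum_le_sum fun j _ => div_le_div_of_nonneg_right ?_ (scaleWeight_pos p j).le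
  exact le_add_of_nonneg_left (sq_nonneg _)

lemma sq_fwdAvg_sub_dyMean_le {J p n : ℕ} (hp : p ≤ J) (f : ℕ → ℝ) (h1 : 2 ^ p ≤ n)
    (h2 : n ≤ 2 ^ (p + 1)) (x : ℕ) :
    (fwdAvg f n x - dyMean p f x) ^ 2 ≤ 8 * totalVar J f p x := by
  rw [← sum_blockErr hp]
  refine (sq_sum_le_sum_div_scaleWeight p _ _).trans
    (mul_le_mul_of_nonneg_left (sum_le_sum fun j _ => ?_) (by norm_num))
  refine div_le_div_of_nonneg_right ?_ (scaleWeight_pos p j).le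
  refine (sq_le_sq_add_sqVar (fun i => blockErr p j (dyDiff J f j) i x) h1).trans ?_
  rw [blockVar]
  gcongr
  exact sqVar_mono _ le_rfl h2

lemma sq_fwdAvg_sub_fwdAvg_le {J p m n : ℕ} (hp : p ≤ J) (f : ℕ → ℝ) (h : m ≤ n) (x : ℕ) :
    (fwdAvg f n x - fwdAvg f m x) ^ 2 ≤ 16 * ∑ i ∈ Ico m n, stepVar J f p i x := by
  rw [← sub_sub_sub_cancel_right _ _ (dyMean p f x), ← sum_blockErr hp, ← sum_blockErr hp,
    ← sum_sub_distrib, sum_stepVar]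
  refine (sq_sum_le_sum_div_scaleWeight p _ _).trans ?_
  rw [show (16 : ℝ) = 8 * 2 by norm_num, mul_assoc, Finset.mul_sum _ _ (2 : ℝ)]
  refine mul_le_mul_of_nonneg_left (sum_le_sum fun j _ => ?_) (by norm_num)
  rw [← mul_div_assoc]
  refine div_le_div_of_nonneg_right ?_ (scaleWeight_pos p j).le
  exact sq_sub_le_sqVar (fun i => blockErr p j (dyDiff J f j) i x) h

lemma sum_blockVar_dyDiff_le {p j J : ℕ} (hp : p ≤ J) (hj : j ≤ J) {f : ℕ → ℝ}
    (hf : ∀ x, 2 ^ J ≤ x → f x = 0) :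
    ∑ x ∈ range (2 ^ J), blockVar p j (dyDiff J f j) x ≤
      56 * (1 / 2) ^ (p - j + (j - p)) * ∑ x ∈ range (2 ^ J), dyDiff J f j x ^ 2 := by
  rcases le_or_gt p j with h | h
  · exact sum_blockVar_le_coarse h hj (blockConst_dyDiff J j f) fun x hx => dyDiff_eq_zero hf j hx
  · have hj' : j < J := h.trans_le hp
    exact sum_blockVar_le_fine h hj' (fun x hx => dyDiff_eq_zero hf j hx) (sum_prefix_dyDiff f hj')

/-- After division by the weight the decay is $(1/2)/(3/4)=2/3$ per scale; the sum over $p$ costs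
$2/(1-2/3)=6$, and the energies of the differences add up to that of $f$. Hence $336=6\cdot56$. -/
lemma sum_sum_totalVar_le {J : ℕ} {f : ℕ → ℝ} (hf : ∀ x, 2 ^ J ≤ x → f x = 0) :
    ∑ x ∈ range (2 ^ J), ∑ p ∈ range (J + 1), totalVar J f p x ≤
      336 * ∑ x ∈ range (2 ^ J), f x ^ 2 := by
  calc _ = ∑ j ∈ range (J + 1), ∑ p ∈ range (J + 1),
        (∑ x ∈ range (2 ^ J), blockVar p j (dyDiff J f j) x) / scaleWeight p j := by
        simp only [totalVar, sum_div]
        rw [sum_comm]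
        simp_rw [sum_comm (s := range (2 ^ J))]
        rw [sum_comm]
    _ ≤ ∑ j ∈ range (J + 1), ∑ p ∈ range (J + 1),
        (2 / 3) ^ (j - p + (p - j)) * (56 * ∑ x ∈ range (2 ^ J), dyDiff J f j x ^ 2) := by
        refine sum_le_sum fun j hj => sum_le_sum fun p hp => ?_
        rw [div_le_iff₀ (scaleWeight_pos p j)]
        refine (sum_blockVar_dyDiff_le (Nat.lt_succ_iff.1 (mem_range.1 hp))
          (Nat.lt_succ_iff.1 (mem_range.1 hj)) hf).trans (le_of_eq ?_)
        rw [scaleWeight, add_comm (j - p), mul_right_comm _ _ ((3 / 4 : ℝ) ^ _), ← mul_pow]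
        norm_num
        ring
    _ ≤ ∑ j ∈ range (J + 1), 6 * (56 * ∑ x ∈ range (2 ^ J), dyDiff J f j x ^ 2) := by
        refine sum_le_sum fun j _ => ?_
        rw [← sum_mul]
        refine mul_le_mul_of_nonneg_right ?_ ?_
        · exact (sum_geom_dist_le (by norm_num) (by norm_num) j _).trans (by norm_num)
        · exact mul_nonneg (by norm_num) (sum_nonneg fun _ _ => sq_nonneg _)
    _ = _ := by
        rw [← mul_sum, ← mul_sum, sum_sum_sq_dyDiff]
        ring

/-! ### The oscillation inequality for sequences -/

lemma sum_sum_Ico_consecutive (g : ℕ → ℝ) {a : ℕ → ℕ} (ha : Monotone a) (K : ℕ) :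
    ∑ k ∈ range K, ∑ i ∈ Ico (a k) (a (k + 1)), g i = ∑ i ∈ Ico (a 0) (a K), g i := by
  induction K with
  | zero => simp
  | succ K ih =>
    rw [sum_range_succ, ih, sum_Ico_consecutive _ (ha (Nat.zero_le K)) (ha (Nat.le_succ K))]

/-- If $M$ and $n$ lie in one dyadic block, the variation inside it suffices. Otherwise both
averages are replaced by the dyadic means of their blocks. The sums run over half-open ranges so
that consecutive intervals of times use disjoint ranges. -/
lemma sq_fwdAvg_sub_le {J M M' n : ℕ} (hM : 0 < M) (h1 : M ≤ n) (h2 : n < M') (hM' : M' ≤ 2 ^ J)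
    (f : ℕ → ℝ) (x : ℕ) :
    (fwdAvg f n x - fwdAvg f M x) ^ 2 ≤
      16 * ∑ i ∈ Ico M M', stepVar J f (Nat.log 2 i) i x +
      24 * (∑ r ∈ Ico (Nat.log 2 M) (Nat.log 2 M'), totalVar J f r x +
        ∑ r ∈ Ico (Nat.log 2 M) (Nat.log 2 M'), totalVar J f (r + 1) x) +
      3 * (dyMean (Nat.log 2 n) f x - dyMean (Nat.log 2 M) f x) ^ 2 := by
  have hn : n ≠ 0 := by omega
  have hlog : ∀ m, m ≤ M' → Nat.log 2 m ≤ J := fun m hm => by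
    have := Nat.log_mono_right (b := 2) (hm.trans hM')
    rwa [Nat.log_pow (by norm_num)] at this
  have hpow : ∀ m, m ≠ 0 → 2 ^ Nat.log 2 m ≤ m ∧ m ≤ 2 ^ (Nat.log 2 m + 1) := fun m hm =>
    ⟨Nat.pow_log_le_self 2 hm, (Nat.lt_pow_succ_log_self (by norm_num) m).le⟩
  have hT : 0 ≤ ∑ r ∈ Ico (Nat.log 2 M) (Nat.log 2 M'), totalVar J f r x :=
    sum_nonneg fun _ _ => totalVar_nonneg _ _ _ _
  have hT' : 0 ≤ ∑ r ∈ Ico (Nat.log 2 M) (Nat.log 2 M'), totalVar J f (r + 1) x :=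
    sum_nonneg fun _ _ => totalVar_nonneg _ _ _ _
  have hS : 0 ≤ ∑ i ∈ Ico M M', stepVar J f (Nat.log 2 i) i x :=
    sum_nonneg fun _ _ => stepVar_nonneg _ _ _ _ _
  rcases (Nat.log_mono_right (b := 2) h1).eq_or_lt with h | h
  · have h3 := sq_fwdAvg_sub_fwdAvg_le (hlog n h2.le) f h1 x
    have h4 : ∑ i ∈ Ico M n, stepVar J f (Nat.log 2 n) i x ≤
        ∑ i ∈ Ico M M', stepVar J f (Nat.log 2 i) i x := by
      calc _ = ∑ i ∈ Ico M n, stepVar J f (Nat.log 2 i) i x := by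
            refine sum_congr rfl fun i hi => ?_
            have hi := mem_Ico.1 hi
            rw [le_antisymm (h ▸ Nat.log_mono_right hi.1) (Nat.log_mono_right hi.2.le)]
        _ ≤ _ := sum_le_sum_of_subset_of_nonneg (Ico_subset_Ico le_rfl h2.le)
            fun _ _ _ => stepVar_nonneg _ _ _ _ _
    nlinarith [sq_nonneg (dyMean (Nat.log 2 n) f x - dyMean (Nat.log 2 M) f x)]
  · have h3 := sq_fwdAvg_sub_dyMean_le (hlog n h2.le) f (hpow n hn).1 (hpow n hn).2 x
    have h4 := sq_fwdAvg_sub_dyMean_le (hlog M (h1.trans h2.le)) f (hpow M hM.ne').1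
      (hpow M hM.ne').2 x
    have hle := Nat.log_mono_right (b := 2) h2.le
    have h5 : totalVar J f (Nat.log 2 M) x ≤
        ∑ r ∈ Ico (Nat.log 2 M) (Nat.log 2 M'), totalVar J f r x :=
      single_le_sum (f := fun r => totalVar J f r x) (fun _ _ => totalVar_nonneg _ _ _ _)
        (mem_Ico.2 ⟨le_rfl, h.trans_le hle⟩)
    -- The block of $n$ may be that of $M'$, outside the half-open range; it is charged to the index
    -- one lower, still at least that of $M$ because the blocks differ.
    have h6 : totalVar J f (Nat.log 2 n) x ≤
        ∑ r ∈ Ico (Nat.log 2 M) (Nat.log 2 M'), totalVar J f (r + 1) x := by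
      have := single_le_sum (f := fun r => totalVar J f (r + 1) x)
        (fun _ _ => totalVar_nonneg _ _ _ _)
        (mem_Ico.2 ⟨show Nat.log 2 M ≤ Nat.log 2 n - 1 by omega,
          show Nat.log 2 n - 1 < Nat.log 2 M' by omega⟩)
      rwa [show Nat.log 2 n - 1 + 1 = Nat.log 2 n by omega] at this
    set A := fwdAvg f n x - dyMean (Nat.log 2 n) f x with hA
    set B := fwdAvg f M x - dyMean (Nat.log 2 M) f x with hB
    set E := dyMean (Nat.log 2 n) f x - dyMean (Nat.log 2 M) f x with hE
    have h7 : fwdAvg f n x - fwdAvg f M x = A - B + E := by rw [hA, hB, hE]; ring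
    rw [h7]
    have h8 : (A - B + E) ^ 2 ≤ 3 * A ^ 2 + 3 * B ^ 2 + 3 * E ^ 2 := by
      nlinarith [sq_nonneg (A + B), sq_nonneg (A - E), sq_nonneg (B + E)]
    linarith

/-- The oscillation inequality for forward averages of a finitely supported sequence, with the
suprema replaced by an arbitrary choice of times. -/
theorem sum_oscillation_le {J K : ℕ} {f : ℕ → ℝ} (hf : ∀ x, 2 ^ J ≤ x → f x = 0) {N : ℕ → ℕ}
    (hN : StrictMono N) (hN0 : ∀ k, 0 < N k) (hK : N K ≤ 2 ^ J) (n : ℕ → ℕ → ℕ)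
    (hn : ∀ x k, N k ≤ n x k ∧ n x k < N (k + 1)) :
    ∑ x ∈ range (2 ^ J), ∑ k ∈ range K, (fwdAvg f (n x k) x - fwdAvg f (N k) x) ^ 2 ≤
      21534 * ∑ x ∈ range (2 ^ J), f x ^ 2 := by
  have hlogmono : Monotone fun k => Nat.log 2 (N k) := fun a b h =>
    Nat.log_mono_right (hN.monotone h)
  have hlogK : Nat.log 2 (N K) ≤ J := by
    have := Nat.log_mono_right (b := 2) hK
    rwa [Nat.log_pow (by norm_num)] at this
  have hpoint : ∀ x, ∑ k ∈ range K, (fwdAvg f (n x k) x - fwdAvg f (N k) x) ^ 2 ≤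
      64 * ∑ p ∈ range (J + 1), totalVar J f p x + 3 * ∑ k ∈ range K,
        (dyMean (Nat.log 2 (n x k)) f x - dyMean (Nat.log 2 (N k)) f x) ^ 2 := by
    intro x
    have h1 := sum_le_sum fun k (hk : k ∈ range K) =>
      sq_fwdAvg_sub_le (hN0 k) (hn x k).1 (hn x k).2
        ((hN.monotone (Nat.succ_le_of_lt (mem_range.1 hk))).trans hK) f x
    refine h1.trans ?_
    rw [sum_add_distrib, sum_add_distrib, ← mul_sum, ← mul_sum, ← mul_sum, sum_add_distrib,
      sum_sum_Ico_consecutive (fun i => stepVar J f (Nat.log 2 i) i x) hN.monotone,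
      sum_sum_Ico_consecutive (fun r => totalVar J f r x) hlogmono,
      sum_sum_Ico_consecutive (fun r => totalVar J f (r + 1) x) hlogmono]
    have h2 : ∑ i ∈ Ico (N 0) (N K), stepVar J f (Nat.log 2 i) i x ≤
        ∑ p ∈ range (J + 1), totalVar J f p x := by
      calc _ ≤ ∑ i ∈ Ico (2 ^ 0) (2 ^ J), stepVar J f (Nat.log 2 i) i x :=
            sum_le_sum_of_subset_of_nonneg (Ico_subset_Ico (hN0 0) hK)
              fun _ _ _ => stepVar_nonneg _ _ _ _ _
        _ = ∑ p ∈ range J, ∑ i ∈ Ico (2 ^ p) (2 ^ (p + 1)), stepVar J f (Nat.log 2 i) i x :=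
            (sum_sum_Ico_consecutive _ (fun a b h => Nat.pow_le_pow_right (by norm_num) h) J).symm
        _ ≤ ∑ p ∈ range J, totalVar J f p x := by
            refine sum_le_sum fun p _ => ?_
            refine le_trans (le_of_eq (sum_congr rfl fun i hi => ?_)) (sum_stepVar_le_totalVar J f p x)
            have hi := mem_Ico.1 hi
            rw [Nat.log_eq_of_pow_le_of_lt_pow hi.1 hi.2]
        _ ≤ _ := sum_le_sum_of_subset_of_nonneg (range_mono (Nat.le_succ J))
              fun _ _ _ => totalVar_nonneg _ _ _ _
    have h3 : ∑ r ∈ Ico (Nat.log 2 (N 0)) (Nat.log 2 (N K)), totalVar J f r x ≤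
        ∑ p ∈ range (J + 1), totalVar J f p x := by
      refine sum_le_sum_of_subset_of_nonneg (fun r hr => ?_) fun _ _ _ => totalVar_nonneg _ _ _ _
      have := mem_Ico.1 hr
      exact mem_range.2 (by omega)
    have h4 : ∑ r ∈ Ico (Nat.log 2 (N 0)) (Nat.log 2 (N K)), totalVar J f (r + 1) x ≤
        ∑ p ∈ range (J + 1), totalVar J f p x := by
      rw [sum_Ico_add' (fun r => totalVar J f r x)]
      refine sum_le_sum_of_subset_of_nonneg (fun r hr => ?_) fun _ _ _ => totalVar_nonneg _ _ _ _
      have := mem_Ico.1 hr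
      exact mem_range.2 (by omega)
    linarith
  have hmart : ∑ k ∈ range K, ∑ x ∈ range (2 ^ J),
      (dyMean (Nat.log 2 (n x k)) f x - dyMean (Nat.log 2 (N k)) f x) ^ 2 ≤
      10 * ∑ x ∈ range (2 ^ J), f x ^ 2 := by
    set E : ℕ → ℝ := fun k => ∑ x ∈ range (2 ^ J), dyMean (Nat.log 2 (N k)) f x ^ 2 with hE
    have h1 : ∀ k ∈ range K, ∑ x ∈ range (2 ^ J),
        (dyMean (Nat.log 2 (n x k)) f x - dyMean (Nat.log 2 (N k)) f x) ^ 2 ≤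
        10 * (E k - E (k + 1)) := fun k hk =>
      sum_sq_dyMean_choice_le (hlogmono (Nat.le_succ k))
        ((hlogmono (Nat.succ_le_of_lt (mem_range.1 hk))).trans hlogK) f _
        fun x => ⟨Nat.log_mono_right (hn x k).1, Nat.log_mono_right (hn x k).2.le⟩
    refine (sum_le_sum h1).trans ?_
    rw [← mul_sum, sum_range_sub']
    have h2 : 0 ≤ E K := sum_nonneg fun _ _ => sq_nonneg _
    have h3 := sum_sq_dyMean_sub (Nat.zero_le _) ((hlogmono (Nat.zero_le K)).trans hlogK) f
    have h4 : 0 ≤ ∑ x ∈ range (2 ^ J), (dyMean 0 f x - dyMean (Nat.log 2 (N 0)) f x) ^ 2 :=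
      sum_nonneg fun _ _ => sq_nonneg _
    simp only [dyMean_zero] at h3 h4
    rw [h3] at h4
    simp only [hE] at h2 ⊢
    linarith
  refine (sum_le_sum fun x _ => hpoint x).trans ?_
  rw [sum_add_distrib, ← mul_sum, ← mul_sum, sum_comm (t := range K)]
  -- $64\cdot336+3\cdot10=21534$, where $64=16+2\cdot24$.
  linarith [sum_sum_totalVar_le hf]

/-! ### Transfer to measure-preserving maps -/

/-- The oscillation of the Birkhoff averages over the times in `[M, M')`. -/
noncomputable def birkhoffOscillation {X : Type*} (T : X → X) (f : X → ℂ) (M M' : ℕ) (x : X) :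
    ℝ≥0∞ :=
  ⨆ n ∈ Set.Ico M M', ‖birkhoffAverage ℂ T f n x - birkhoffAverage ℂ T f M x‖ₑ

lemma exists_birkhoffOscillation_eq {X : Type*} (T : X → X) (f : X → ℂ) {M M' : ℕ} (h : M < M')
    (x : X) : ∃ n, (M ≤ n ∧ n < M') ∧ birkhoffOscillation T f M M' x =
      ‖birkhoffAverage ℂ T f n x - birkhoffAverage ℂ T f M x‖ₑ := by
  obtain ⟨n, hn, hmax⟩ := exists_max_image (Ico M M')
    (fun n => ‖birkhoffAverage ℂ T f n x - birkhoffAverage ℂ T f M x‖ₑ) ⟨M, mem_Ico.2 ⟨le_rfl, h⟩⟩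
  refine ⟨n, mem_Ico.1 hn, le_antisymm ?_ ?_⟩
  · exact iSup₂_le fun i hi => hmax i (mem_Ico.2 hi)
  · exact le_iSup₂ (f := fun i (_ : i ∈ Set.Ico M M') =>
      ‖birkhoffAverage ℂ T f i x - birkhoffAverage ℂ T f M x‖ₑ) n (mem_Ico.1 hn)

/-- The first `P` values of a real function along an orbit, continued by `0`. -/
def orbitSeq {X : Type*} (T : X → X) (g : X → ℝ) (x : X) (P i : ℕ) : ℝ :=
  if i < P then g (T^[i] x) else 0

lemma fwdAvg_orbitSeq {X : Type*} (T : X → X) (g : X → ℝ) (x : X) {P n m : ℕ} (h : m + n ≤ P) :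
    fwdAvg (orbitSeq T g x P) n m = (∑ i ∈ range n, g (T^[i] (T^[m] x))) / n := by
  rw [fwdAvg]
  congr 1
  refine sum_congr rfl fun i hi => ?_
  have := mem_range.1 hi
  rw [orbitSeq, if_pos (by omega), ← Function.iterate_add_apply, add_comm]

/-- The oscillation of a complex function is attained at some time depending on the point; since the
sequence inequality holds for any choice of times, it applies to the real and imaginary parts with
that same choice. An orbit segment of length $2^{J+1}$ contains every window of length at most $2^J$
starting before $2^J$. -/
lemma sum_sum_birkhoffOscillation_sq_le {X : Type*} (T : X → X) (f : X → ℂ) {N : ℕ → ℕ}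
    (hN : StrictMono N) (hN0 : ∀ k, 0 < N k) {J K : ℕ} (hK : N K ≤ 2 ^ J) (x : X) :
    ∑ m ∈ range (2 ^ J), ∑ k ∈ range K,
        birkhoffOscillation T f (N k) (N (k + 1)) (T^[m] x) ^ 2 ≤
      21534 * ∑ m ∈ range (2 ^ (J + 1)), ‖f (T^[m] x)‖ₑ ^ 2 := by
  choose n hn hosc using fun m k =>
    exists_birkhoffOscillation_eq T f (hN (Nat.lt_succ_self k)) (T^[m] x)
  set u := orbitSeq T (fun y => (f y).re) x (2 ^ (J + 1)) with hu
  set v := orbitSeq T (fun y => (f y).im) x (2 ^ (J + 1)) with hv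
  have hzero : ∀ g : X → ℝ, ∀ i, 2 ^ (J + 1) ≤ i → orbitSeq T g x (2 ^ (J + 1)) i = 0 :=
    fun g i hi => if_neg (not_lt.2 hi)
  have hK' : N K ≤ 2 ^ (J + 1) := hK.trans (Nat.pow_le_pow_right (by norm_num) (Nat.le_succ J))
  have h1 := sum_oscillation_le (hzero fun y => (f y).re) hN hN0 hK' n hn
  have h2 := sum_oscillation_le (hzero fun y => (f y).im) hN hN0 hK' n hn
  have hnorm : ∀ z : ℂ, ‖z‖ₑ ^ 2 = ENNReal.ofReal (z.re ^ 2 + z.im ^ 2) := fun z => by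
    rw [← ofReal_norm, ← ENNReal.ofReal_pow (norm_nonneg _), Complex.sq_norm, Complex.normSq_apply]
    congr 1; ring
  have hterm : ∀ m ∈ range (2 ^ J), ∀ k ∈ range K,
      birkhoffOscillation T f (N k) (N (k + 1)) (T^[m] x) ^ 2 =
        ENNReal.ofReal ((fwdAvg u (n m k) m - fwdAvg u (N k) m) ^ 2 +
          (fwdAvg v (n m k) m - fwdAvg v (N k) m) ^ 2) := by
    intro m hm k hk
    have hm := mem_range.1 hm
    have hNk : N (k + 1) ≤ 2 ^ J := (hN.monotone (Nat.succ_le_of_lt (mem_range.1 hk))).trans hK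
    have hb : ∀ l, l ≤ 2 ^ J → birkhoffAverage ℂ T f l (T^[m] x) =
        ⟨fwdAvg u l m, fwdAvg v l m⟩ := by
      intro l hl
      have hml : m + l ≤ 2 ^ (J + 1) := by rw [pow_succ]; omega
      rw [hu, hv, fwdAvg_orbitSeq T _ x hml, fwdAvg_orbitSeq T _ x hml]
      have : birkhoffAverage ℂ T f l (T^[m] x) = birkhoffAverage ℝ T f l (T^[m] x) := by
        rw [birkhoffAverage_congr_ring ℂ ℝ]
      rw [this, birkhoffAverage, birkhoffSum]
      apply Complex.ext
      · simp only [Complex.smul_re, Complex.re_sum, smul_eq_mul, div_eq_inv_mul]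
      · simp only [Complex.smul_im, Complex.im_sum, smul_eq_mul, div_eq_inv_mul]
    have h3 := hn m k
    rw [hosc, hb _ (h3.2.le.trans hNk), hb _ ((h3.1.trans h3.2.le).trans hNk), hnorm]
    simp
  have hterm2 : ∀ m ∈ range (2 ^ (J + 1)), ‖f (T^[m] x)‖ₑ ^ 2 =
      ENNReal.ofReal (u m ^ 2 + v m ^ 2) := by
    intro m hm
    rw [hnorm, hu, hv, orbitSeq, orbitSeq, if_pos (mem_range.1 hm), if_pos (mem_range.1 hm)]
  rw [sum_congr rfl fun m hm => sum_congr rfl (hterm m hm), sum_congr rfl hterm2]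
  have hnn : ∀ a b : ℝ, 0 ≤ a ^ 2 + b ^ 2 := fun a b => by positivity
  rw [sum_congr rfl fun m _ => (ENNReal.ofReal_sum_of_nonneg fun k _ => hnn _ _).symm,
    ← ENNReal.ofReal_sum_of_nonneg fun m _ => sum_nonneg fun k _ => hnn _ _,
    ← ENNReal.ofReal_sum_of_nonneg fun m _ => hnn _ _,
    show (21534 : ℝ≥0∞) = ENNReal.ofReal 21534 by norm_num,
    ← ENNReal.ofReal_mul (by norm_num)]
  refine ENNReal.ofReal_le_ofReal ?_
  refine (sum_le_sum_of_subset_of_nonneg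
    (range_mono (Nat.pow_le_pow_right (by norm_num) (Nat.le_succ J)))
    fun m _ _ => sum_nonneg fun k _ => hnn _ _).trans ?_
  simp only [sum_add_distrib, mul_add]
  exact add_le_add h1 h2

lemma measurable_birkhoffAverage {X : Type*} [MeasurableSpace X] {T : X → X} (hT : Measurable T)
    {f : X → ℂ} (hf : Measurable f) (n : ℕ) : Measurable (birkhoffAverage ℂ T f n) := by
  have : birkhoffAverage ℂ T f n = fun x => (n : ℂ)⁻¹ • ∑ k ∈ range n, f (T^[k] x) := rfl
  rw [this]
  exact Measurable.const_smul (Finset.measurable_sum _ fun k _ => hf.comp (hT.iterate k)) (n : ℂ)⁻¹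

lemma measurable_birkhoffOscillation {X : Type*} [MeasurableSpace X] {T : X → X}
    (hT : Measurable T) {f : X → ℂ} (hf : Measurable f) (M M' : ℕ) :
    Measurable (birkhoffOscillation T f M M') :=
  Measurable.iSup fun _ => Measurable.iSup fun _ =>
    ((measurable_birkhoffAverage hT hf _).sub (measurable_birkhoffAverage hT hf _)).enorm

/-- **The oscillation inequality** in `L²` for the Birkhoff averages of a measure-preserving map. -/
theorem tsum_lintegral_birkhoffOscillation_sq_le {X : Type*} [MeasurableSpace X] {μ : Measure X}
    {T : X → X} (hT : MeasurePreserving T μ μ) {f : X → ℂ} (hf : Measurable f) {N : ℕ → ℕ}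
    (hN : StrictMono N) (hN0 : ∀ k, 0 < N k) :
    ∑' k, ∫⁻ x, birkhoffOscillation T f (N k) (N (k + 1)) x ^ 2 ∂μ ≤
      43068 * ∫⁻ x, ‖f x‖ₑ ^ 2 ∂μ := by
  have hmeas : ∀ k, Measurable fun x => birkhoffOscillation T f (N k) (N (k + 1)) x ^ 2 :=
    fun k => (measurable_birkhoffOscillation hT.measurable hf _ _).pow_const 2
  have hfm : Measurable fun x => ‖f x‖ₑ ^ 2 := hf.enorm.pow_const 2
  have hmeas' : ∀ m k, Measurable fun x =>
      birkhoffOscillation T f (N k) (N (k + 1)) (T^[m] x) ^ 2 :=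
    fun m k => (hmeas k).comp (hT.measurable.iterate m)
  have hfm' : ∀ m, Measurable fun x => ‖f (T^[m] x)‖ₑ ^ 2 :=
    fun m => hfm.comp (hT.measurable.iterate m)
  refine ENNReal.tsum_le_of_sum_range_le fun K => ?_
  obtain ⟨J, hJ⟩ : ∃ J, N K ≤ 2 ^ J := ⟨N K, Nat.lt_two_pow_self.le⟩
  have h1 := lintegral_mono (μ := μ) fun x => sum_sum_birkhoffOscillation_sq_le T f hN hN0 hJ x
  have hL : ∫⁻ x, ∑ m ∈ range (2 ^ J), ∑ k ∈ range K,
      birkhoffOscillation T f (N k) (N (k + 1)) (T^[m] x) ^ 2 ∂μ =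
      2 ^ J * ∑ k ∈ range K, ∫⁻ x, birkhoffOscillation T f (N k) (N (k + 1)) x ^ 2 ∂μ := by
    rw [lintegral_finsetSum _ fun m _ => Finset.measurable_sum _ fun k _ => hmeas' m k]
    have : ∀ m ∈ range (2 ^ J), ∫⁻ x, ∑ k ∈ range K,
        birkhoffOscillation T f (N k) (N (k + 1)) (T^[m] x) ^ 2 ∂μ =
        ∑ k ∈ range K, ∫⁻ x, birkhoffOscillation T f (N k) (N (k + 1)) x ^ 2 ∂μ := by
      intro m _
      rw [lintegral_finsetSum _ fun k _ => hmeas' m k]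
      exact sum_congr rfl fun k _ => (hT.iterate m).lintegral_comp (hmeas k)
    rw [sum_congr rfl this, sum_const, card_range, nsmul_eq_mul]
    push_cast
    rfl
  have hR : ∫⁻ x, 21534 * ∑ m ∈ range (2 ^ (J + 1)), ‖f (T^[m] x)‖ₑ ^ 2 ∂μ =
      2 ^ J * (43068 * ∫⁻ x, ‖f x‖ₑ ^ 2 ∂μ) := by
    rw [lintegral_const_mul _ (Finset.measurable_sum _ fun m _ => hfm' m),
      lintegral_finsetSum _ fun m _ => hfm' m,
      sum_congr rfl fun m _ => (hT.iterate m).lintegral_comp hfm, sum_const, card_range,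
      nsmul_eq_mul]
    push_cast
    rw [pow_succ, show (43068 : ℝ≥0∞) = 21534 * 2 by norm_num]
    ring
  rw [hL, hR] at h1
  -- By invariance every starting point contributes the same integral: $2^J$ of them on the left,
  -- $2^{J+1}$ on the right. Hence the doubled constant, independent of $J$.
  exact (ENNReal.mul_le_mul_iff_right (by positivity) (by finiteness)).1 h1

end DyadicOscillation

/-! ### The Boole map preserves the Cauchy measure -/

lemma measurable_booleMap : Measurable booleMap := by
  unfold booleMap
  exact Measurable.ite (measurableSet_singleton 0) measurable_const (by fun_prop)

lemma hasDerivAt_booleMap {x : ℝ} (hx : x ≠ 0) :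
    HasDerivAt booleMap ((1 + (x ^ 2)⁻¹) / 2) x := by
  have h1 : HasDerivAt (fun y : ℝ => (1 / 2) * (y - y⁻¹)) ((1 / 2) * (1 - -(x ^ 2)⁻¹)) x :=
    ((hasDerivAt_id x).sub (hasDerivAt_inv hx)).const_mul _
  have h2 : booleMap =ᶠ[nhds x] fun y : ℝ => (1 / 2) * (y - y⁻¹) := by
    filter_upwards [isOpen_ne.mem_nhds hx] with y hy
    rw [booleMap, if_neg hy, one_div y]
  refine (h1.congr_of_eventuallyEq h2).congr_deriv ?_
  ring

lemma cauchyPDFReal_booleMap {x : ℝ} (hx : x ≠ 0) :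
    (1 + (x ^ 2)⁻¹) / 2 * cauchyPDFReal 0 1 (booleMap x) = 2 * cauchyPDFReal 0 1 x := by
  simp only [cauchyPDFReal, booleMap, if_neg hx]
  have h1 : (1 / 2 * (x - 1 / x) - 0) ^ 2 + ((1 : NNReal) : ℝ) ^ 2 =
      (x ^ 2 + 1) ^ 2 / (4 * x ^ 2) := by
    push_cast
    field_simp
    ring
  have h2 : x ^ 2 + 1 ≠ 0 := by positivity
  rw [h1]
  push_cast
  field_simp
  simp
  ring

lemma booleMap_sub {x y : ℝ} (hx : x ≠ 0) (hy : y ≠ 0) :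
    booleMap x - booleMap y = (x - y) * ((1 + (x * y)⁻¹) / 2) := by
  simp only [booleMap, if_neg hx, if_neg hy]
  field_simp
  ring

lemma exists_booleMap_eq (a : ℝ) : (∃ x > 0, booleMap x = a) ∧ ∃ x < 0, booleMap x = a := by
  have h1 : Real.sqrt (a ^ 2 + 1) ^ 2 = a ^ 2 + 1 := Real.sq_sqrt (by positivity)
  have h2 : |a| < Real.sqrt (a ^ 2 + 1) := by
    rw [← Real.sqrt_sq_eq_abs]; exact Real.sqrt_lt_sqrt (by positivity) (by linarith)
  have h3 := abs_lt.1 h2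
  refine ⟨⟨a + Real.sqrt (a ^ 2 + 1), by linarith, ?_⟩, a - Real.sqrt (a ^ 2 + 1), by linarith, ?_⟩
  · have : a + Real.sqrt (a ^ 2 + 1) ≠ 0 := by linarith
    rw [booleMap, if_neg this]
    field_simp
    linarith
  · have : a - Real.sqrt (a ^ 2 + 1) ≠ 0 := by linarith
    rw [booleMap, if_neg this]
    field_simp
    linarith

/-- Change of variables on one branch; $S$ will be each open half-line, where the map is injective
and onto. Each branch carries exactly half of the Cauchy mass, since the pulled-back density is
twice the original. -/
lemma setLIntegral_comp_booleMap {S : Set ℝ} (hS : MeasurableSet S) (h0 : ∀ x ∈ S, x ≠ 0)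
    (hmul : ∀ x ∈ S, ∀ y ∈ S, 0 < x * y) (hsurj : booleMap '' S = Set.univ) {g : ℝ → ℝ≥0∞} :
    ∫⁻ x, cauchyPDF 0 1 x * g x = 2 * ∫⁻ x in S, cauchyPDF 0 1 x * g (booleMap x) := by
  have hinj : Set.InjOn booleMap S := by
    intro x hx y hy hxy
    have h1 := booleMap_sub (h0 x hx) (h0 y hy)
    rw [hxy, sub_self] at h1
    have h2 : 0 < (1 + (x * y)⁻¹) / 2 := by have := hmul x hx y hy; positivity
    have := (mul_eq_zero.1 h1.symm).resolve_right h2.ne'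
    linarith
  have h := lintegral_image_eq_lintegral_abs_deriv_mul hS
    (fun x hx => (hasDerivAt_booleMap (h0 x hx)).hasDerivWithinAt) hinj
    fun x => cauchyPDF 0 1 x * g x
  rw [hsurj, setLIntegral_univ] at h
  rw [h, ← lintegral_const_mul' _ _ (by norm_num)]
  refine setLIntegral_congr_fun hS fun x hx => ?_
  have hx0 := h0 x hx
  rw [← mul_assoc, ← mul_assoc, abs_of_pos (by positivity), cauchyPDF, cauchyPDF,
    ← ENNReal.ofReal_mul (by positivity), cauchyPDFReal_booleMap hx0,
    ENNReal.ofReal_mul (by norm_num)]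
  norm_num

theorem measurePreserving_booleMap :
    MeasurePreserving booleMap (cauchyMeasure 0 1) (cauchyMeasure 0 1) := by
  refine ⟨measurable_booleMap, ?_⟩
  refine Measure.ext_of_lintegral _ fun g hg => ?_
  have hg' : Measurable fun x => g (booleMap x) := hg.comp measurable_booleMap
  rw [lintegral_map hg measurable_booleMap, cauchyMeasure_of_scale_ne_zero 0 one_ne_zero,
    lintegral_withDensity_eq_lintegral_mul _ (by fun_prop) hg',
    lintegral_withDensity_eq_lintegral_mul _ (by fun_prop) hg]
  simp only [Pi.mul_apply]
  have h1 := setLIntegral_comp_booleMap (g := g) measurableSet_Ioi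
    (fun x (hx : x ∈ Set.Ioi (0 : ℝ)) => ne_of_gt hx) (fun x hx y hy => mul_pos hx hy)
    (Set.eq_univ_of_forall fun a => (exists_booleMap_eq a).1)
  have h2 := setLIntegral_comp_booleMap (g := g) measurableSet_Iio
    (fun x (hx : x ∈ Set.Iio (0 : ℝ)) => ne_of_lt hx) (fun x hx y hy => mul_pos_of_neg_of_neg hx hy)
    (Set.eq_univ_of_forall fun a => (exists_booleMap_eq a).2)
  have h3 := lintegral_add_compl (μ := volume)
    (fun x => cauchyPDF 0 1 x * g (booleMap x)) (measurableSet_Ioi (a := (0 : ℝ)))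
  rw [Set.compl_Ioi, ← setLIntegral_congr Iio_ae_eq_Iic] at h3
  have h4 : (2 : ℝ≥0∞) * ∫⁻ x, cauchyPDF 0 1 x * g (booleMap x) =
      2 * ∫⁻ x, cauchyPDF 0 1 x * g x := by
    rw [← h3, mul_add]
    rw [← h1, ← h2, two_mul]
  exact (ENNReal.mul_right_inj (by norm_num) (by norm_num)).1 h4

/-- Stated for general targets because it serves both complex functions and the `ℝ≥0∞`-valued
oscillation. -/
lemma eLpNorm_two_sq {α ε : Type*} [MeasurableSpace α] [TopologicalSpace ε] [ContinuousENorm ε]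
    (f : α → ε) (μ : Measure α) : eLpNorm f 2 μ ^ 2 = ∫⁻ x, ‖f x‖ₑ ^ 2 ∂μ := by
  have h := eLpNorm_nnreal_pow_eq_lintegral (f := f) (μ := μ) (p := 2) two_ne_zero
  simp only [NNReal.coe_ofNat, ENNReal.rpow_ofNat] at h
  exact h

/-! ### Plancherel's theorem for integrable, square-integrable functions -/

section Plancherel

open FourierTransform SchwartzMap
open scoped SchwartzMap ContDiff

/-- The `L²` Fourier transform agrees with the Fourier integral on `L¹ ∩ L²`. -/
lemma fourier_toLp_ae_eq {f : ℝ → ℂ} (hf : Integrable f) (hf2 : MemLp f 2) :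
    ((𝓕 (hf2.toLp f) : Lp ℂ 2 (volume : Measure ℝ)) : ℝ → ℂ) =ᵐ[volume] 𝓕 f := by
  refine ae_eq_of_integral_contDiff_smul_eq
    ((Lp.memLp _).locallyIntegrable (by norm_num)) ?_ fun g hg hgc => ?_
  · refine Continuous.locallyIntegrable ?_
    exact VectorFourier.fourierIntegral_continuous Real.continuous_fourierChar
      (by exact continuous_inner) hf
  · have hg1 : HasCompactSupport (fun x => (g x : ℂ)) := hgc.comp_left Complex.ofReal_zero
    have hg2 : ContDiff ℝ ∞ (fun x => (g x : ℂ)) := Complex.ofRealCLM.contDiff.comp hg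
    set G : 𝓢(ℝ, ℂ) := hg1.toSchwartzMap hg2 with hG
    have h1 := congrArg (fun u : 𝓢'(ℝ, ℂ) => u G)
      (Lp.fourier_toTemperedDistribution_eq (hf2.toLp f))
    simp only [TemperedDistribution.fourier_apply, Lp.toTemperedDistribution_apply] at h1
    have h2 : ∫ x, (𝓕 G) x • (hf2.toLp f) x = ∫ x, (𝓕 G) x • f x := by
      refine integral_congr_ae ?_
      filter_upwards [hf2.coeFn_toLp] with x hx
      rw [hx]
    -- The multiplication formula moves the transform off the test function, so both candidates
    -- define the same distribution.
    have h3 := VectorFourier.integral_fourierIntegral_smul_eq_flip (μ := (volume : Measure ℝ))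
      (ν := (volume : Measure ℝ)) (L := innerₗ ℝ) Real.continuous_fourierChar
      (by exact continuous_inner) hf G.integrable
    simp only [flip_innerₗ] at h3
    have h4 : ∫ x, (𝓕 G) x • f x = ∫ x, G x • 𝓕 f x := by
      refine Eq.trans ?_ (h3.symm.trans ?_)
      · refine integral_congr_ae (Filter.Eventually.of_forall fun x => ?_)
        simp only [smul_eq_mul]
        rw [mul_comm]
        rfl
      · refine integral_congr_ae (Filter.Eventually.of_forall fun x => ?_)
        simp only [smul_eq_mul]
        rw [mul_comm]
        rfl
    rw [h2, h4] at h1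
    have h5 : ∀ x, ∀ z : ℂ, g x • z = G x • z := fun x z => by
      rw [Complex.real_smul, smul_eq_mul]; rfl
    simp only [h5]
    exact h1.symm

/-- **Plancherel's theorem** on `L¹ ∩ L²`. -/
theorem lintegral_enorm_fourier_sq {f : ℝ → ℂ} (hf : Integrable f) (hf2 : MemLp f 2) :
    ∫⁻ ξ, ‖𝓕 f ξ‖ₑ ^ 2 = ∫⁻ x, ‖f x‖ₑ ^ 2 := by
  have h1 := congrArg ENNReal.ofReal (Lp.norm_fourier_eq (hf2.toLp f))
  simp only [Lp.norm_def, ENNReal.ofReal_toReal (Lp.memLp _).eLpNorm_ne_top] at h1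
  rw [eLpNorm_congr_ae (fourier_toLp_ae_eq hf hf2), eLpNorm_congr_ae hf2.coeFn_toLp] at h1
  rw [← eLpNorm_two_sq, ← eLpNorm_two_sq, h1]

end Plancherel

section ZetaMellin

open Set Filter Topology Complex

/-! ### Mellin transforms of the fractional part -/

/-- The map $x+iy\mapsto a+e^x+iy$ carries the plane without $\log(c-a)$ onto this set. -/
lemma isPreconnected_halfPlane_diff {a c : ℝ} (hac : a < c) :
    IsPreconnected {s : ℂ | a < s.re ∧ s ≠ c} := by
  have h := (isConnected_compl_singleton_of_one_lt_rank
    (by simp [Complex.rank_real_complex]) (Real.log (c - a) : ℂ)).isPreconnected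
  have hφ : Continuous fun z : ℂ => ((a + Real.exp z.re : ℝ) : ℂ) + (z.im : ℂ) * I := by fun_prop
  convert h.image _ hφ.continuousOn using 1
  ext s
  constructor
  · rintro ⟨h1, h2⟩
    have h3 : 0 < s.re - a := by linarith
    refine ⟨⟨Real.log (s.re - a), s.im⟩, fun h4 => h2 ?_, ?_⟩
    · have h5 := congrArg Complex.re (mem_singleton_iff.1 h4)
      have h6 := congrArg Complex.im (mem_singleton_iff.1 h4)
      simp only [ofReal_re, ofReal_im] at h5 h6
      have h7 := Real.log_injOn_pos (mem_Ioi.2 h3) (mem_Ioi.2 (sub_pos.2 hac)) h5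
      apply Complex.ext
      · simp only [ofReal_re]; linarith
      · simp only [ofReal_im]; exact h6
    · simp only [Real.exp_log h3, add_sub_cancel]
      exact re_add_im s
  · rintro ⟨z, hz, rfl⟩
    refine ⟨?_, fun h4 => hz ?_⟩
    · simp only [add_re, ofReal_re, mul_re, ofReal_im, I_re, I_im]
      linarith [Real.exp_pos z.re]
    · have h5 := congrArg Complex.re h4
      have h6 := congrArg Complex.im h4
      simp only [add_re, ofReal_re, mul_re, ofReal_im, I_re, I_im, add_im, mul_im] at h5 h6
      rw [mem_singleton_iff]
      apply Complex.ext
      · rw [ofReal_re, show c - a = Real.exp z.re by linarith, Real.log_exp]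
      · rw [ofReal_im]; linarith

/-- `∫_1^∞ {t} ^ k t ^ (-s - 1) dt`. -/
noncomputable def fractTail (k : ℕ) (s : ℂ) : ℂ :=
  ∫ t in Ioi (1 : ℝ), ((Int.fract t ^ k : ℝ) : ℂ) * (t : ℂ) ^ (-(s + 1))

lemma fractTail_eq_mellin (k : ℕ) (s : ℂ) :
    fractTail k s =
      mellin ((Ioi (1 : ℝ)).indicator fun t => ((Int.fract t ^ k : ℝ) : ℂ)) (-s) := by
  have h : ∀ t : ℝ, (t : ℂ) ^ (-s - 1) • (Ioi (1 : ℝ)).indicator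
      (fun t => ((Int.fract t ^ k : ℝ) : ℂ)) t =
      (Ioi (1 : ℝ)).indicator
        (fun t : ℝ => ((Int.fract t ^ k : ℝ) : ℂ) * (t : ℂ) ^ (-(s + 1))) t := by
    intro t
    by_cases ht : t ∈ Ioi (1 : ℝ)
    · rw [indicator_of_mem ht, indicator_of_mem ht, smul_eq_mul, mul_comm, neg_add']
    · rw [indicator_of_notMem ht, indicator_of_notMem ht, smul_zero]
  simp only [mellin, h]
  rw [setIntegral_indicator measurableSet_Ioi, fractTail, Ioi_inter_Ioi]
  norm_num

lemma measurable_ofReal_fract_pow (k : ℕ) :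
    Measurable fun t : ℝ => ((Int.fract t ^ k : ℝ) : ℂ) :=
  (measurable_fract.pow_const k).complex_ofReal

lemma norm_ofReal_fract_pow_le (k : ℕ) (t : ℝ) : ‖((Int.fract t ^ k : ℝ) : ℂ)‖ ≤ 1 := by
  rw [norm_real, Real.norm_eq_abs, abs_of_nonneg (pow_nonneg (Int.fract_nonneg t) k)]
  exact pow_le_one₀ (Int.fract_nonneg t) (Int.fract_lt_one t).le

lemma differentiableAt_fractTail (k : ℕ) {s : ℂ} (hs : 0 < s.re) :
    DifferentiableAt ℂ (fractTail k) s := by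
  have h1 : fractTail k = fun s =>
      mellin ((Ioi (1 : ℝ)).indicator fun t => ((Int.fract t ^ k : ℝ) : ℂ)) (-s) :=
    funext (fractTail_eq_mellin k)
  rw [h1]
  have hb : ∀ t, ‖(Ioi (1 : ℝ)).indicator (fun t => ((Int.fract t ^ k : ℝ) : ℂ)) t‖ ≤ 1 :=
    fun t => (norm_indicator_le_norm_self _ t).trans (norm_ofReal_fract_pow_le k t)
  have hm : Measurable ((Ioi (1 : ℝ)).indicator fun t => ((Int.fract t ^ k : ℝ) : ℂ)) :=
    (measurable_ofReal_fract_pow k).indicator measurableSet_Ioi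
  -- The function is bounded at infinity and vanishes near $0$, so any exponent $b$ below $-\Re s$
  -- works.
  have h2 := mellin_differentiableAt_of_isBigO_rpow (a := 0) (b := -s.re - 1)
    (f := (Ioi (1 : ℝ)).indicator fun t => ((Int.fract t ^ k : ℝ) : ℂ)) (s := -s)
    ((memLp_top_of_bound hm.aestronglyMeasurable 1 (Eventually.of_forall hb)).locallyIntegrable
      (by simp) |>.locallyIntegrableOn _)
    (Asymptotics.isBigO_iff.2 ⟨1, Eventually.of_forall fun t => by simpa using hb t⟩)
    (by simpa using hs) ?_ (by simp)
  · exact h2.comp s differentiableAt_id.neg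
  · refine Asymptotics.isBigO_iff.2 ⟨1, ?_⟩
    filter_upwards [Ioo_mem_nhdsGT (zero_lt_one (α := ℝ))] with t ht
    rw [indicator_of_notMem (by simpa using ht.2.le)]
    simp

lemma integrableOn_mul_cpow {g : ℝ → ℂ} (hg : Measurable g) {r : ℝ}
    (hb : ∀ t, 1 < t → ‖g t‖ ≤ t ^ r) {s : ℂ} (hs : r < s.re) :
    IntegrableOn (fun t : ℝ => g t * (t : ℂ) ^ (-(s + 1))) (Ioi 1) := by
  have h1 : IntegrableOn (fun t : ℝ => t ^ (r - s.re - 1)) (Ioi 1) :=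
    integrableOn_Ioi_rpow_of_lt (by linarith) one_pos
  refine Integrable.mono' h1 (by fun_prop) ?_
  filter_upwards [ae_restrict_mem measurableSet_Ioi] with t ht
  have ht0 : 0 < t := one_pos.trans ht
  rw [norm_mul, norm_cpow_eq_rpow_re_of_pos ht0]
  calc _ ≤ t ^ r * t ^ (-(s + 1)).re := by
        have := hb t ht; gcongr
    _ = _ := by
        rw [← Real.rpow_add ht0]; congr 1; simp; ring

lemma integral_pow_mul_cpow (k : ℕ) {s : ℂ} (hs : k < s.re) :
    ∫ t in Ioi (1 : ℝ), (t : ℂ) ^ k * (t : ℂ) ^ (-(s + 1)) = 1 / (s - k) := by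
  have h : ∀ t ∈ Ioi (1 : ℝ), (t : ℂ) ^ k * (t : ℂ) ^ (-(s + 1)) = (t : ℂ) ^ (k - s - 1) := by
    intro t ht
    have ht0 : (t : ℂ) ≠ 0 := ofReal_ne_zero.2 (one_pos.trans ht).ne'
    rw [← cpow_natCast, ← cpow_add _ _ ht0]
    congr 1; ring
  rw [setIntegral_congr_fun measurableSet_Ioi h, integral_Ioi_cpow_of_lt (by simp; linarith) one_pos]
  rw [ofReal_one, one_cpow, show (k : ℂ) - s - 1 + 1 = -(s - k) by ring, neg_div_neg_eq]

lemma riemannZeta_eq_integral_floor {s : ℂ} (hs : 1 < s.re) :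
    riemannZeta s = s * ∫ t in Ioi (1 : ℝ), (⌊t⌋₊ : ℂ) * (t : ℂ) ^ (-(s + 1)) := by
  have h := LSeries_eq_mul_integral_of_nonneg (fun _ => 1) zero_le_one hs ?_ fun _ => zero_le_one
  · simp only [Finset.sum_const, Nat.card_Icc, ofReal_one, nsmul_eq_mul, mul_one,
      Nat.add_sub_cancel] at h
    rw [← h, ← LSeries_one_eq_riemannZeta hs]
    rfl
  · simp only [Finset.sum_const, Nat.card_Icc, nsmul_eq_mul, mul_one, Nat.add_sub_cancel,
      Real.rpow_one]
    exact Asymptotics.isBigO_refl _ _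

lemma sum_Icc_two_mul_sub_one (n : ℕ) : ∑ k ∈ Finset.Icc 1 n, (2 * (k : ℂ) - 1) = (n : ℂ) ^ 2 := by
  induction n with
  | zero => simp
  | succ n ih => rw [Finset.sum_Icc_succ_top (by omega), ih]; push_cast; ring

/-- Partial summation for the coefficients $2n-1$, whose partial sums are the squares. -/
lemma riemannZeta_eq_integral_floor_sq {s : ℂ} (hs : 2 < s.re) :
    2 * riemannZeta (s - 1) - riemannZeta s =
      s * ∫ t in Ioi (1 : ℝ), (⌊t⌋₊ : ℂ) ^ 2 * (t : ℂ) ^ (-(s + 1)) := by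
  have hs1 : 1 < (s - 1).re := by simp; linarith
  have hs2 : 1 < s.re := by linarith
  have hterm : ∀ n, LSeries.term (fun n => 2 * (n : ℂ) - 1) s n =
      2 * LSeries.term 1 (s - 1) n - LSeries.term 1 s n := by
    intro n
    rcases eq_or_ne n 0 with rfl | hn
    · simp
    · have hn' : (n : ℂ) ≠ 0 := Nat.cast_ne_zero.2 hn
      rw [LSeries.term_of_ne_zero hn, LSeries.term_of_ne_zero hn, LSeries.term_of_ne_zero hn,
        cpow_sub _ _ hn', cpow_one]
      simp only [Pi.one_apply]
      have : (n : ℂ) ^ s ≠ 0 := by simp [cpow_eq_zero_iff, hn']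
      field_simp
  have hS1 := LSeriesSummable_one_iff.2 hs1
  have hS2 := LSeriesSummable_one_iff.2 hs2
  have hS : LSeriesSummable (fun n => 2 * (n : ℂ) - 1) s := by
    refine (summable_congr hterm).2 ((Summable.mul_left 2 hS1).sub hS2)
  have hL : LSeries (fun n => 2 * (n : ℂ) - 1) s = 2 * riemannZeta (s - 1) - riemannZeta s := by
    rw [← LSeries_one_eq_riemannZeta hs1, ← LSeries_one_eq_riemannZeta hs2, LSeries,
      tsum_congr hterm, (Summable.mul_left 2 hS1).tsum_sub hS2, tsum_mul_left]
    rfl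
  have h := LSeries_eq_mul_integral _ zero_le_two hs hS ?_
  · simp only [sum_Icc_two_mul_sub_one] at h
    rw [← hL, h]
  · simp only [sum_Icc_two_mul_sub_one]
    refine Asymptotics.isBigO_iff.2 ⟨1, Eventually.of_forall fun n => ?_⟩
    simp

lemma ofReal_fract_eq {t : ℝ} (ht : 1 < t) : ((Int.fract t : ℝ) : ℂ) = t - (⌊t⌋₊ : ℂ) := by
  have : Int.fract t = t - (⌊t⌋₊ : ℝ) := by
    rw [Int.fract, natCast_floor_eq_intCast_floor (by linarith)]
  rw [this]; push_cast; rfl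

lemma norm_floor_le {t : ℝ} (ht : 1 < t) : ‖(⌊t⌋₊ : ℂ)‖ ≤ t := by
  rw [norm_natCast]; exact Nat.floor_le (by linarith)

lemma fractTail_one_of_one_lt {s : ℂ} (hs : 1 < s.re) :
    fractTail 1 s = 1 / (s - 1) - riemannZeta s / s := by
  have hs0 : s ≠ 0 := by rintro rfl; simp at hs; linarith
  have h1 : IntegrableOn (fun t : ℝ => (t : ℂ) ^ 1 * (t : ℂ) ^ (-(s + 1))) (Ioi 1) :=
    integrableOn_mul_cpow (r := 1) (by fun_prop) (fun t ht => by
      rw [pow_one, norm_real, Real.rpow_one, Real.norm_eq_abs, abs_of_pos (by linarith)]) hs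
  have h2 : IntegrableOn (fun t : ℝ => (⌊t⌋₊ : ℂ) * (t : ℂ) ^ (-(s + 1))) (Ioi 1) :=
    integrableOn_mul_cpow (r := 1) (by fun_prop)
      (fun t ht => by rw [Real.rpow_one]; exact norm_floor_le ht) hs
  have h3 := integral_pow_mul_cpow 1 (s := s) (by simpa using hs)
  rw [Nat.cast_one] at h3
  rw [riemannZeta_eq_integral_floor hs, mul_div_cancel_left₀ _ hs0, ← h3, ← integral_sub h1 h2,
    fractTail]
  refine setIntegral_congr_fun measurableSet_Ioi fun t ht => ?_
  simp only [pow_one]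
  rw [ofReal_fract_eq ht]
  ring

/-- Expand $\{t\}^2=t^2-2t\lfloor t\rfloor+\lfloor t\rfloor^2$; the cross term is the floor integral
at $s-1$. Each piece converges only for $\Re s>2$, so the strip is reached by continuation. -/
lemma fractTail_two_of_two_lt {s : ℂ} (hs : 2 < s.re) :
    fractTail 2 s = 1 / (s - 2) - 2 * (riemannZeta (s - 1) / (s - 1)) +
      (2 * riemannZeta (s - 1) - riemannZeta s) / s := by
  have hs0 : s ≠ 0 := by rintro rfl; simp at hs; linarith
  have hs1 : s - 1 ≠ 0 := by
    intro h
    have := congrArg Complex.re h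
    simp at this; linarith
  have h1 : IntegrableOn (fun t : ℝ => (t : ℂ) ^ 2 * (t : ℂ) ^ (-(s + 1))) (Ioi 1) :=
    integrableOn_mul_cpow (r := 2) (by fun_prop) (fun t ht => by
      rw [norm_pow, norm_real, Real.rpow_two, Real.norm_eq_abs, sq_abs]) hs
  have h2 : IntegrableOn (fun t : ℝ => (⌊t⌋₊ : ℂ) ^ 2 * (t : ℂ) ^ (-(s + 1))) (Ioi 1) :=
    integrableOn_mul_cpow (r := 2) (by fun_prop)
      (fun t ht => by
        rw [Real.rpow_two, norm_pow]
        exact pow_le_pow_left₀ (norm_nonneg _) (norm_floor_le ht) 2) hs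
  have h4 : IntegrableOn (fun t : ℝ => ((⌊t⌋₊ : ℂ) * t) * (t : ℂ) ^ (-(s + 1))) (Ioi 1) :=
    integrableOn_mul_cpow (r := 2) (by fun_prop)
      (fun t ht => by
        rw [Real.rpow_two, norm_mul, norm_real, Real.norm_eq_abs, abs_of_pos (by linarith), sq]
        exact mul_le_mul_of_nonneg_right (norm_floor_le ht) (by linarith)) hs
  have h3 := integral_pow_mul_cpow 2 (s := s) (by simpa using hs)
  have h5 : ∫ t in Ioi (1 : ℝ), ((⌊t⌋₊ : ℂ) * t) * (t : ℂ) ^ (-(s + 1)) =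
      ∫ t in Ioi (1 : ℝ), (⌊t⌋₊ : ℂ) * (t : ℂ) ^ (-((s - 1) + 1)) := by
    refine setIntegral_congr_fun measurableSet_Ioi fun t ht => ?_
    have ht0 : (t : ℂ) ≠ 0 := ofReal_ne_zero.2 (one_pos.trans ht).ne'
    rw [mul_assoc]
    congr 1
    nth_rw 1 [← cpow_one (t : ℂ)]
    rw [← cpow_add _ _ ht0]
    congr 1; ring
  have h6 : Integrable (fun t : ℝ => (t : ℂ) ^ 2 * (t : ℂ) ^ (-(s + 1)) -
      2 * (((⌊t⌋₊ : ℂ) * t) * (t : ℂ) ^ (-(s + 1)))) (volume.restrict (Ioi 1)) :=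
    Integrable.sub h1 (Integrable.const_mul h4 2)
  rw [Nat.cast_two] at h3
  rw [riemannZeta_eq_integral_floor_sq hs, mul_div_cancel_left₀ _ hs0,
    riemannZeta_eq_integral_floor (s := s - 1) (by simp; linarith), mul_div_cancel_left₀ _ hs1,
    ← h5, ← h3, ← integral_const_mul, ← integral_sub h1 (h4.const_mul 2),
    ← integral_add h6 h2, fractTail]
  refine setIntegral_congr_fun measurableSet_Ioi fun t ht => ?_
  simp only [ofReal_pow]
  rw [ofReal_fract_eq ht]
  ring

lemma eq_of_eq_of_lt_re {a b c : ℝ} (hac : a < c) (hab : a ≤ b) {f g : ℂ → ℂ}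
    (hf : ∀ s : ℂ, a < s.re → s ≠ c → DifferentiableAt ℂ f s)
    (hg : ∀ s : ℂ, a < s.re → s ≠ c → DifferentiableAt ℂ g s)
    (hfg : ∀ s : ℂ, b < s.re → f s = g s) {s : ℂ} (hs : a < s.re) (hsc : s ≠ c) : f s = g s := by
  have hopen : IsOpen {s : ℂ | a < s.re ∧ s ≠ c} :=
    (isOpen_lt continuous_const continuous_re).inter isOpen_ne
  have hF : AnalyticOnNhd ℂ f {s : ℂ | a < s.re ∧ s ≠ c} :=
    DifferentiableOn.analyticOnNhd (fun s hs => (hf s hs.1 hs.2).differentiableWithinAt) hopen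
  have hG : AnalyticOnNhd ℂ g {s : ℂ | a < s.re ∧ s ≠ c} :=
    DifferentiableOn.analyticOnNhd (fun s hs => (hg s hs.1 hs.2).differentiableWithinAt) hopen
  set z : ℂ := ((max b c + 1 : ℝ) : ℂ) with hz
  have hzb : b < z.re := by
    rw [hz, ofReal_re]; linarith [le_max_left b c]
  have hzc : z ≠ c := by
    intro h
    have := ofReal_injective h
    linarith [le_max_right b c]
  refine hF.eqOn_of_preconnected_of_eventuallyEq hG (isPreconnected_halfPlane_diff hac)
    (z₀ := z) ⟨hab.trans_lt hzb, hzc⟩ ?_ ⟨hs, hsc⟩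
  filter_upwards [(isOpen_lt continuous_const continuous_re).mem_nhds hzb] with w hw
  exact hfg w hw

lemma ne_zero_of_lt_re {a : ℝ} (ha : 0 ≤ a) {s : ℂ} (hs : a < s.re) : s ≠ 0 := by
  rintro rfl
  simp at hs; linarith

theorem fractTail_one {s : ℂ} (hs : 0 < s.re) (hs1 : s ≠ 1) :
    fractTail 1 s = 1 / (s - 1) - riemannZeta s / s := by
  refine eq_of_eq_of_lt_re (a := 0) (b := 1) (c := 1) one_pos zero_le_one
    (f := fractTail 1) (g := fun s => 1 / (s - 1) - riemannZeta s / s)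
    (fun s hs _ => differentiableAt_fractTail 1 hs) (fun s hs hs1 => ?_)
    (fun s hs => fractTail_one_of_one_lt hs) hs (by simpa using hs1)
  rw [ofReal_one] at hs1
  have h0 := ne_zero_of_lt_re le_rfl hs
  have h1 := sub_ne_zero.2 hs1
  have hz := differentiableAt_riemannZeta hs1
  exact ((differentiableAt_const _).div (differentiableAt_id.sub_const (1 : ℂ)) h1).sub
    (hz.div differentiableAt_id h0)

theorem fractTail_two {s : ℂ} (hs : 1 < s.re) (hs2 : s ≠ 2) :
    fractTail 2 s = 1 / (s - 2) - 2 * (riemannZeta (s - 1) / (s - 1)) +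
      (2 * riemannZeta (s - 1) - riemannZeta s) / s := by
  refine eq_of_eq_of_lt_re (a := 1) (b := 2) (c := 2) one_lt_two one_le_two
    (f := fractTail 2) (g := fun s => 1 / (s - 2) - 2 * (riemannZeta (s - 1) / (s - 1)) +
      (2 * riemannZeta (s - 1) - riemannZeta s) / s)
    (fun s hs _ => differentiableAt_fractTail 2 (one_pos.trans hs)) (fun s hs hs2 => ?_)
    (fun s hs => fractTail_two_of_two_lt hs) hs (by simpa using hs2)
  rw [ofReal_ofNat] at hs2
  have h0 := ne_zero_of_lt_re zero_le_one hs
  have h1 : s - 1 ≠ 0 := ne_zero_of_lt_re (a := 0) le_rfl (by simpa using hs)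
  have h2 := sub_ne_zero.2 hs2
  have hz := differentiableAt_riemannZeta (s := s) (sub_ne_zero.1 h1)
  have hz1 : DifferentiableAt ℂ (fun s => riemannZeta (s - 1)) s :=
    (differentiableAt_riemannZeta (s := s - 1) fun h => hs2 (by linear_combination h)).comp s
      (differentiableAt_id.sub_const (1 : ℂ))
  exact (((differentiableAt_const _).div (differentiableAt_id.sub_const (2 : ℂ)) h2).sub
    ((hz1.div (differentiableAt_id.sub_const (1 : ℂ)) h1).const_mul 2)).add
    (((hz1.const_mul 2).sub hz).div differentiableAt_id h0)

end ZetaMellin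

section ZetaMeanSquare

open Set Filter Topology Complex FourierTransform

/-! ### The mean square of zeta on a vertical line in the critical strip -/

/-- On $(0,1)$ the fractional part is $t$, contributing $1/(k-s)$. This cancels the term $1/(s-k)$
in the continued tail and leaves only zeta values. -/
lemma mellin_fract_pow {k : ℕ} {s : ℂ} (hs0 : 0 < s.re) (hsk : s.re < k) :
    MellinConvergent (fun t => ((Int.fract t ^ k : ℝ) : ℂ)) (-s) ∧
      mellin (fun t => ((Int.fract t ^ k : ℝ) : ℂ)) (-s) = 1 / (k - s) + fractTail k s := by
  have hre : -1 < (k - s - 1).re := by simp; linarith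
  have hcongr : EqOn (fun t : ℝ => (t : ℂ) ^ (-s - 1) • ((Int.fract t ^ k : ℝ) : ℂ))
      (fun t : ℝ => (t : ℂ) ^ (k - s - 1)) (Ioo 0 1) := by
    intro t ht
    have ht0 : (t : ℂ) ≠ 0 := ofReal_ne_zero.2 ht.1.ne'
    simp only [smul_eq_mul]
    rw [Int.fract_eq_self.2 ⟨ht.1.le, ht.2⟩, ofReal_pow, ← cpow_natCast, ← cpow_add _ _ ht0]
    congr 1; ring
  have hint : IntegrableOn (fun t : ℝ => (t : ℂ) ^ (k - s - 1)) (Ioc 0 1) :=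
    (intervalIntegrable_iff_integrableOn_Ioc_of_le zero_le_one).1
      (intervalIntegral.intervalIntegrable_cpow' hre)
  have h1 : IntegrableOn (fun t : ℝ => (t : ℂ) ^ (-s - 1) • ((Int.fract t ^ k : ℝ) : ℂ))
      (Ioc 0 1) := by
    rw [integrableOn_Ioc_iff_integrableOn_Ioo]
    exact (integrableOn_congr_fun hcongr measurableSet_Ioo).2 (hint.mono_set Ioo_subset_Ioc_self)
  have h2 : ∫ t in Ioc (0 : ℝ) 1, (t : ℂ) ^ (-s - 1) • ((Int.fract t ^ k : ℝ) : ℂ) =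
      1 / (k - s) := by
    have hne : (k : ℂ) - s ≠ 0 := by
      intro h
      have := congrArg Complex.re h
      simp at this; linarith
    rw [integral_Ioc_eq_integral_Ioo, setIntegral_congr_fun measurableSet_Ioo hcongr,
      ← integral_Ioc_eq_integral_Ioo, ← intervalIntegral.integral_of_le zero_le_one,
      integral_cpow (Or.inl hre), sub_add_cancel, ofReal_one, one_cpow, ofReal_zero,
      zero_cpow hne, sub_zero]
  have hpt : ∀ t : ℝ, (t : ℂ) ^ (-s - 1) • ((Int.fract t ^ k : ℝ) : ℂ) =
      ((Int.fract t ^ k : ℝ) : ℂ) * (t : ℂ) ^ (-(s + 1)) := by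
    intro t
    rw [smul_eq_mul, mul_comm, neg_add']
  have h3 : IntegrableOn (fun t : ℝ => (t : ℂ) ^ (-s - 1) • ((Int.fract t ^ k : ℝ) : ℂ))
      (Ioi 1) := by
    simp only [hpt]
    exact integrableOn_mul_cpow (r := 0) (measurable_ofReal_fract_pow k)
      (fun t _ => by rw [Real.rpow_zero]; exact norm_ofReal_fract_pow_le k t) hs0
  have hU : Ioc (0 : ℝ) 1 ∪ Ioi 1 = Ioi 0 := Ioc_union_Ioi_eq_Ioi zero_le_one
  refine ⟨?_, ?_⟩
  · rw [MellinConvergent, ← hU]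
    exact h1.union h3
  · rw [mellin, ← hU, setIntegral_union (Ioc_disjoint_Ioi le_rfl) measurableSet_Ioi h1 h3, h2,
      fractTail]
    simp only [hpt]

theorem mellin_fract {s : ℂ} (hs0 : 0 < s.re) (hs1 : s.re < 1) :
    mellin (fun t => ((Int.fract t ^ 1 : ℝ) : ℂ)) (-s) = -(riemannZeta s / s) := by
  have h1 : s ≠ 1 := by rintro rfl; simp at hs1
  rw [(mellin_fract_pow hs0 (by simpa using hs1)).2, fractTail_one hs0 h1, Nat.cast_one,
    ← neg_sub s 1, div_neg]
  ring

theorem mellin_fract_sq {σ : ℝ} (h0 : 1 / 2 < σ) (h1 : σ < 1) :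
    mellin (fun t => ((Int.fract t ^ 2 : ℝ) : ℂ)) (-(2 * (σ : ℂ))) =
      -(1 / σ * (riemannZeta (2 * (σ : ℂ)) / 2 +
        riemannZeta (2 * (σ : ℂ) - 1) / (2 * (σ : ℂ) - 1))) := by
  have hre : (2 * (σ : ℂ)).re = 2 * σ := by simp
  have h2 : 2 * (σ : ℂ) ≠ 2 := by
    intro h
    have := congrArg Complex.re h
    simp at this; linarith
  have h3 : 2 * (σ : ℂ) - 1 ≠ 0 := by
    intro h
    have := congrArg Complex.re h
    simp at this; linarith
  have h4 : (σ : ℂ) ≠ 0 := ofReal_ne_zero.2 (by linarith)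
  rw [(mellin_fract_pow (k := 2) (by rw [hre]; linarith) (by rw [hre]; push_cast; linarith)).2,
    fractTail_two (by rw [hre]; linarith) h2, Nat.cast_two, ← neg_sub (2 * (σ : ℂ)) 2, div_neg]
  field_simp
  ring

lemma lintegral_Ioi_eq_lintegral_comp_exp_neg (h : ℝ → ℝ≥0∞) :
    ∫⁻ t in Ioi 0, h t = ∫⁻ u, ENNReal.ofReal (Real.exp (-u)) * h (Real.exp (-u)) := by
  have himg : (fun u : ℝ => Real.exp (-u)) '' univ = Ioi 0 := by
    ext t
    constructor
    · rintro ⟨u, _, rfl⟩; exact Real.exp_pos _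
    · intro ht
      exact ⟨-Real.log t, mem_univ _, by simp only [neg_neg]; exact Real.exp_log ht⟩
  have hder : ∀ u ∈ univ, HasDerivWithinAt (fun u : ℝ => Real.exp (-u)) (-Real.exp (-u)) univ u :=
    fun u _ => HasDerivAt.hasDerivWithinAt (by simpa using (hasDerivAt_id u).neg.exp)
  have hinj : InjOn (fun u : ℝ => Real.exp (-u)) univ :=
    fun u _ v _ huv => neg_injective (Real.exp_injective huv)
  rw [← himg, lintegral_image_eq_lintegral_abs_deriv_mul MeasurableSet.univ hder hinj,
    setLIntegral_univ]
  simp only [abs_neg, Real.abs_exp]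

/-- The function whose Fourier transform gives `-ζ(s) / s` on the line `Re s = σ`. -/
noncomputable def fractExp (σ u : ℝ) : ℂ :=
  Real.exp (σ * u) • ((Int.fract (Real.exp (-u)) ^ 1 : ℝ) : ℂ)

lemma measurable_fractExp (σ : ℝ) : Measurable (fractExp σ) := by
  have h : Measurable fun u : ℝ => Int.fract (Real.exp (-u)) := measurable_fract.comp (by fun_prop)
  have h2 : Measurable fun u : ℝ => Real.exp (σ * u) * Int.fract (Real.exp (-u)) ^ 1 :=
    (by fun_prop : Measurable fun u : ℝ => Real.exp (σ * u)).mul (h.pow_const 1)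
  convert h2.complex_ofReal using 2 with u
  simp [fractExp]

/-- Substitution $t=e^{-u}$. The case $k=1$ gives integrability, and $k=2$ gives the $L^2$ norm for
Plancherel. -/
lemma lintegral_enorm_fractExp_pow (σ : ℝ) (k : ℕ) :
    ∫⁻ u, ‖fractExp σ u‖ₑ ^ k =
      ∫⁻ t in Ioi 0, ENNReal.ofReal (t ^ (-(k * σ) - 1) * Int.fract t ^ k) := by
  rw [lintegral_Ioi_eq_lintegral_comp_exp_neg]
  refine lintegral_congr fun u => ?_
  have hf := Int.fract_nonneg (Real.exp (-u))
  rw [fractExp, ← ofReal_norm, norm_smul, Real.norm_eq_abs, Real.abs_exp, norm_real,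
    Real.norm_eq_abs, pow_one, abs_of_nonneg hf, ← ENNReal.ofReal_pow (by positivity),
    ← ENNReal.ofReal_mul (by positivity), ← mul_assoc, mul_pow, ← Real.exp_nat_mul, ← Real.exp_mul,
    ← Real.exp_add]
  congr 3
  ring

lemma lintegral_rpow_mul_fract_pow {k : ℕ} {σ : ℝ} (h0 : 0 < k * σ) (h1 : k * σ < k) :
    ∫⁻ t in Ioi 0, ENNReal.ofReal (t ^ (-(k * σ) - 1) * Int.fract t ^ k) =
      ‖mellin (fun t => ((Int.fract t ^ k : ℝ) : ℂ)) (-((k * σ : ℝ) : ℂ))‖ₑ := by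
  have hconv := (mellin_fract_pow (k := k) (s := ((k * σ : ℝ) : ℂ))
    (by rwa [ofReal_re]) (by rwa [ofReal_re])).1
  have hcongr : EqOn
      (fun t : ℝ => (t : ℂ) ^ (-((k * σ : ℝ) : ℂ) - 1) • ((Int.fract t ^ k : ℝ) : ℂ))
      (fun t : ℝ => ((t ^ (-(k * σ) - 1) * Int.fract t ^ k : ℝ) : ℂ)) (Ioi 0) := by
    intro t ht
    simp only [smul_eq_mul]
    rw [ofReal_mul (t ^ _), ofReal_cpow (le_of_lt ht), ofReal_sub, ofReal_neg, ofReal_one]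
  have hint : IntegrableOn (fun t : ℝ => t ^ (-(k * σ) - 1) * Int.fract t ^ k) (Ioi 0) := by
    have h : Integrable _ (volume.restrict (Ioi (0 : ℝ))) :=
      (integrableOn_congr_fun hcongr measurableSet_Ioi).1 hconv
    have h' := h.re
    simp only [RCLike.re_eq_complex_re, ofReal_re] at h'
    exact h'
  have hnn : ∀ t ∈ Ioi (0 : ℝ), 0 ≤ t ^ (-(k * σ) - 1) * Int.fract t ^ k := fun t ht =>
    mul_nonneg (Real.rpow_nonneg (le_of_lt ht) _) (pow_nonneg (Int.fract_nonneg t) k)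
  rw [mellin, setIntegral_congr_fun measurableSet_Ioi hcongr, integral_complex_ofReal,
    ← ofReal_norm, norm_real, Real.norm_eq_abs,
    abs_of_nonneg (setIntegral_nonneg measurableSet_Ioi hnn),
    ofReal_integral_eq_lintegral_ofReal hint]
  filter_upwards [ae_restrict_mem measurableSet_Ioi] with t ht using hnn t ht

lemma lintegral_comp_neg_div_two_pi (h : ℝ → ℝ≥0∞) :
    ∫⁻ τ, h (-τ / (2 * Real.pi)) = ENNReal.ofReal (2 * Real.pi) * ∫⁻ ξ, h ξ := by
  have hπ := Real.pi_pos
  have himg : (fun ξ : ℝ => -(2 * Real.pi * ξ)) '' univ = univ :=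
    image_univ_of_surjective fun τ => ⟨-τ / (2 * Real.pi), by field_simp⟩
  have hder : ∀ ξ ∈ univ,
      HasDerivWithinAt (fun ξ : ℝ => -(2 * Real.pi * ξ)) (-(2 * Real.pi)) univ ξ := fun ξ _ => by
    have := ((hasDerivAt_id ξ).const_mul (2 * Real.pi)).fun_neg
    rw [mul_one] at this
    exact this.hasDerivWithinAt
  have hinj : InjOn (fun ξ : ℝ => -(2 * Real.pi * ξ)) univ := fun u _ v _ huv => by
    have := neg_injective huv
    exact mul_left_cancel₀ (by positivity) this
  have := lintegral_image_eq_lintegral_abs_deriv_mul MeasurableSet.univ hder hinj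
    fun τ => h (-τ / (2 * Real.pi))
  rw [himg, setLIntegral_univ, setLIntegral_univ] at this
  rw [this, ← lintegral_const_mul' _ _ ENNReal.ofReal_ne_top]
  refine lintegral_congr fun ξ => ?_
  rw [abs_neg, abs_of_pos (by positivity)]
  congr 2
  field_simp

/-- The mean square of `ζ(s) / s` on the line `Re s = σ`. -/
theorem lintegral_enorm_riemannZeta_div_sq {σ : ℝ} (h0 : 1 / 2 < σ) (h1 : σ < 1) :
    ∫⁻ τ : ℝ, ‖riemannZeta (σ + I * τ) / (σ + I * τ)‖ₑ ^ 2 =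
      ENNReal.ofReal (2 * Real.pi) * ENNReal.ofReal (1 / σ *
        ‖riemannZeta (2 * (σ : ℂ)) / 2 +
          riemannZeta (2 * (σ : ℂ) - 1) / (2 * (σ : ℂ) - 1)‖) := by
  have hσ : 0 < σ := by linarith
  have hL1 : Integrable (fractExp σ) := by
    refine ⟨(measurable_fractExp σ).aestronglyMeasurable, ?_⟩
    have h := lintegral_enorm_fractExp_pow σ 1
    simp only [pow_one (‖fractExp σ _‖ₑ)] at h
    rw [HasFiniteIntegral, h, lintegral_rpow_mul_fract_pow (by simpa using hσ) (by simpa using h1)]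
    exact enorm_lt_top
  have hval := lintegral_rpow_mul_fract_pow (k := 2) (σ := σ) (by positivity)
    (by push_cast; linarith)
  have hsq := (lintegral_enorm_fractExp_pow σ 2).trans hval
  have hL2 : MemLp (fractExp σ) 2 := by
    refine ⟨(measurable_fractExp σ).aestronglyMeasurable, ?_⟩
    have h : eLpNorm (fractExp σ) 2 volume ^ 2 < ⊤ := by
      rw [eLpNorm_two_sq, hsq]
      exact enorm_lt_top
    exact (ENNReal.pow_lt_top_iff.1 h).resolve_right two_ne_zero
  have hF : ∀ τ : ℝ, ‖riemannZeta (σ + I * τ) / (σ + I * τ)‖ₑ =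
      ‖𝓕 (fractExp σ) (-τ / (2 * Real.pi))‖ₑ := by
    intro τ
    have hre : ((σ : ℂ) + I * τ).re = σ := by simp
    have him : (-((σ : ℂ) + I * τ)).im = -τ := by simp
    have hm := mellin_fract (s := σ + I * τ) (by rw [hre]; exact hσ) (by rw [hre]; exact h1)
    rw [← enorm_neg, ← hm, mellin_eq_fourier, him, neg_re, hre]
    simp only [neg_neg]
    rfl
  simp only [hF]
  rw [lintegral_comp_neg_div_two_pi fun ξ => ‖𝓕 (fractExp σ) ξ‖ₑ ^ 2,
    lintegral_enorm_fourier_sq hL1 hL2, hsq]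
  congr 1
  rw [show ((((2 : ℕ) : ℝ) * σ : ℝ) : ℂ) = 2 * (σ : ℂ) by push_cast; rfl, mellin_fract_sq h0 h1,
    enorm_neg, ← ofReal_norm, norm_mul, norm_div, norm_one, norm_real,
    Real.norm_eq_abs, abs_of_pos hσ]

lemma continuous_riemannZeta_vertical {s : ℂ} (hs : s.re < 1) :
    Continuous fun y : ℝ => riemannZeta (s + I * y) := by
  refine continuous_iff_continuousAt.2 fun y => ?_
  have h : s + I * y ≠ 1 := by
    intro h
    have := congrArg Complex.re h
    simp at this; linarith
  exact (differentiableAt_riemannZeta h).continuousAt.comp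
    (f := fun y : ℝ => s + I * (y : ℂ)) (by fun_prop)

/-- Since $\sigma<1$, $\sigma^2+(t+x)^2\le2(1+t^2)(1+x^2)$: recentring the Cauchy weight at $-t$
costs a factor of order $1+t^2$. -/
lemma cauchyPDFReal_mul_le {σ : ℝ} (h0 : 0 < σ) (h1 : σ < 1) (t x : ℝ) (z : ℂ) :
    cauchyPDFReal 0 1 x * ‖z‖ ^ 2 ≤
      2 / Real.pi * (1 + t ^ 2) * ‖z / (σ + I * ((t + x : ℝ) : ℂ))‖ ^ 2 := by
  have hn : ‖(σ : ℂ) + I * ((t + x : ℝ) : ℂ)‖ ^ 2 = σ ^ 2 + (t + x) ^ 2 := by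
    rw [Complex.sq_norm, normSq_apply]
    simp
    ring
  have hπ := Real.pi_pos
  have hd : 0 < σ ^ 2 + (t + x) ^ 2 := by positivity
  have key : σ ^ 2 + (t + x) ^ 2 ≤ 2 * (1 + t ^ 2) * (x ^ 2 + 1) := by
    nlinarith [sq_nonneg (t - x), sq_nonneg (t * x)]
  have hcoef : (x ^ 2 + 1)⁻¹ ≤ 2 * (1 + t ^ 2) / (σ ^ 2 + (t + x) ^ 2) := by
    rw [le_div_iff₀ hd, inv_mul_le_iff₀ (by positivity)]
    linarith
  rw [norm_div, div_pow, hn]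
  calc cauchyPDFReal 0 1 x * ‖z‖ ^ 2 = Real.pi⁻¹ * (x ^ 2 + 1)⁻¹ * ‖z‖ ^ 2 := by
        simp [cauchyPDFReal]
    _ ≤ Real.pi⁻¹ * (2 * (1 + t ^ 2) / (σ ^ 2 + (t + x) ^ 2)) * ‖z‖ ^ 2 := by gcongr
    _ = _ := by ring

lemma lintegral_riemannZeta_cauchyMeasure_le {σ : ℝ} (h0 : 1 / 2 < σ) (h1 : σ < 1) (t : ℝ) :
    ∫⁻ x : ℝ, ‖riemannZeta (σ + I * t + I * x)‖ₑ ^ 2 ∂(cauchyMeasure 0 1) ≤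
      ENNReal.ofReal (4 * (1 + t ^ 2) / σ * ‖riemannZeta (2 * (σ : ℂ)) / 2 +
          riemannZeta (2 * (σ : ℂ) - 1) / (2 * (σ : ℂ) - 1)‖) := by
  have hσ : 0 < σ := by linarith
  have hπ := Real.pi_pos
  have hm : Measurable fun x : ℝ => ‖riemannZeta (σ + I * t + I * x)‖ₑ ^ 2 :=
    (continuous_riemannZeta_vertical (by simpa using h1)).measurable.enorm.pow_const 2
  rw [cauchyMeasure_of_scale_ne_zero 0 one_ne_zero,
    lintegral_withDensity_eq_lintegral_mul _ (by fun_prop) hm]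
  have hpt : ∀ x : ℝ, (cauchyPDF 0 1 * fun x : ℝ => ‖riemannZeta (σ + I * t + I * x)‖ₑ ^ 2) x ≤
      ENNReal.ofReal (2 / Real.pi * (1 + t ^ 2)) *
        ‖riemannZeta (σ + I * ((t + x : ℝ) : ℂ)) / (σ + I * ((t + x : ℝ) : ℂ))‖ₑ ^ 2 := by
    intro x
    have hz : (σ : ℂ) + I * t + I * x = σ + I * ((t + x : ℝ) : ℂ) := by push_cast; ring
    simp only [Pi.mul_apply, hz]
    rw [cauchyPDF, ← ofReal_norm, ← ofReal_norm, ← ENNReal.ofReal_pow (norm_nonneg _),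
      ← ENNReal.ofReal_pow (norm_nonneg _), ← ENNReal.ofReal_mul' (by positivity),
      ← ENNReal.ofReal_mul' (by positivity)]
    exact ENNReal.ofReal_le_ofReal (cauchyPDFReal_mul_le hσ h1 t x _)
  refine (lintegral_mono hpt).trans (le_of_eq ?_)
  -- Translation by $t$ removes the shift, and the constants combine as $\frac2\pi\cdot2\pi=4$.
  rw [lintegral_const_mul' _ _ ENNReal.ofReal_ne_top,
    lintegral_add_left_eq_self
      (fun τ : ℝ => ‖riemannZeta (σ + I * τ) / (σ + I * τ)‖ₑ ^ 2) t,
    lintegral_enorm_riemannZeta_div_sq h0 h1, ← ENNReal.ofReal_mul (by positivity),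
    ← ENNReal.ofReal_mul (by positivity)]
  congr 1
  generalize ‖riemannZeta (2 * (σ : ℂ)) / 2 + riemannZeta (2 * (σ : ℂ) - 1) / (2 * (σ : ℂ) - 1)‖ = Z
  field_simp
  ring

end ZetaMeanSquare

/-! ### Combination of the oscillation inequality with the mean square of zeta -/

theorem theorem4 :
    ∃ C : ℝ, 0 < C ∧
      ∀ σ t : ℝ, 1 / 2 < σ → σ < 1 →
        ∀ N : ℕ → ℕ, StrictMono N → (∀ k, 0 < N k) →
          ∑' k : ℕ,
              (eLpNorm (zetaOscillation ((σ : ℂ) + Complex.I * (t : ℂ)) (N k) (N (k + 1))) 2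
                (cauchyMeasure 0 1)) ^ 2 ≤
            ENNReal.ofReal
              (C * (1 + t ^ 2) / (Real.pi * σ) *
                ‖riemannZeta (2 * (σ : ℂ)) / 2 +
                  riemannZeta (2 * (σ : ℂ) - 1) / (2 * (σ : ℂ) - 1)‖) := by
  have hπ := Real.pi_pos
  -- Oscillation constant times mean-square constant; the factor $\pi$ only cancels the $\pi$ in the
  -- stated denominator.
  refine ⟨43068 * 4 * Real.pi, by positivity, fun σ t h0 h1 N hN hN0 => ?_⟩
  have hσ : 0 < σ := by linarith
  have hf : Measurable fun y : ℝ =>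
      riemannZeta ((σ : ℂ) + Complex.I * (t : ℂ) + Complex.I * (y : ℂ)) :=
    (continuous_riemannZeta_vertical (by simpa using h1)).measurable
  have h := DyadicOscillation.tsum_lintegral_birkhoffOscillation_sq_le
    measurePreserving_booleMap hf hN hN0
  calc _ = ∑' k, ∫⁻ x, DyadicOscillation.birkhoffOscillation booleMap
        (fun y : ℝ => riemannZeta ((σ : ℂ) + Complex.I * (t : ℂ) + Complex.I * (y : ℂ)))
        (N k) (N (k + 1)) x ^ 2 ∂(cauchyMeasure 0 1) :=
        tsum_congr fun k => eLpNorm_two_sq _ _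
    _ ≤ _ := h
    _ ≤ 43068 * ENNReal.ofReal (4 * (1 + t ^ 2) / σ * ‖riemannZeta (2 * (σ : ℂ)) / 2 +
          riemannZeta (2 * (σ : ℂ) - 1) / (2 * (σ : ℂ) - 1)‖) :=
        mul_le_mul_right (lintegral_riemannZeta_cauchyMeasure_le h0 h1 t) _
    _ = _ := by
        rw [show (43068 : ℝ≥0∞) = ENNReal.ofReal 43068 by norm_num,
          ← ENNReal.ofReal_mul (by norm_num)]
        congr 1
        generalize ‖riemannZeta (2 * (σ : ℂ)) / 2 +
          riemannZeta (2 * (σ : ℂ) - 1) / (2 * (σ : ℂ) - 1)‖ = Z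
        field_simp
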